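/- Let $k$ be a field of arbitrary characteristic, let $V=k[[t]]$ with order function $\operatorname{o}$, and let $A=k[[t^5,t^{11}]]\subseteq V$ be the semigroup ring of $H=\langle 5,11\rangle$, i.e. the ring of all power series whose exponents lie in $H$. An ideal $I$ of a Cohen–Macaulay local ring $(R,\mathfrak m)$ is an Ulrich ideal if it is $\mathfrak m$-primary and contains a parameter ideal $Q$ as a reduction such that $I\ne Q$, $I^2=QI$, and $I/I^2$ is a free $R/I$-module. An ideal $I$ of $A$ has invariants $(a,b)$ if there are $f,g\in I$ with $I=(f,g)$, $I^2=fI$, $\operatorname{o}(f)=a<b=\operatorname{o}(g)$ and $b-a\notin H$. Then the set of Ulrich ideals of $A$ with invariants $(a,b)=(20,26)$ equals $$\left\{\left(t^{20}+3\varepsilon t^{21}+\varepsilon^2t^{22}+(2\tau-55\varepsilon^7)t^{27}+\delta t^{33},\ t^{26}+2\varepsilon t^{27}+\tau t^{33}\right)\ \middle|\ \delta,\varepsilon,\tau\in k,\ \varepsilon\ne0\right\}.$$ Moreover the parameters are uniquely determined by the ideal: if $(\delta,\varepsilon,\tau)$ and $(\delta',\varepsilon',\tau')$ in $k^3$ with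 $\varepsilon,\varepsilon'\ne0$ give the same ideal, then $\delta=\delta'$, $\varepsilon=\varepsilon'$ and $\tau=\tau'$. -/

import Mathlib

open scoped PowerSeries

namespace UlrichIdeals

section General

variable {R : Type*} [CommRing R] [IsLocalRing R]

/-- A parameter ideal of a (Noetherian) local ring `R`: an ideal generated by `dim R` elements
which is primary to the maximal ideal. -/
def IsParameterIdeal (Q : Ideal R) : Prop :=
  ∃ (d : ℕ) (x : Fin d → R), ringKrullDim R = d ∧ Q = Ideal.span (Set.range x) ∧
    Q.radical = IsLocalRing.maximalIdeal R

/-- Ulrich ideals of a Cohen-Macaulay local ring `R`: an ideal `I`, primary to the maximal ideal,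
containing a parameter ideal `Q` as a reduction such that `I ≠ Q`, `I ^ 2 = Q I`, and `I / I ^ 2`
(Mathlib's `I.Cotangent`) is a free `R / I`-module. That `Q` is a reduction of `I` is contained
in `Q ≤ I` and `I ^ 2 = Q I`. -/
def IsUlrich (I : Ideal R) : Prop :=
  I.radical = IsLocalRing.maximalIdeal R ∧
  (∃ Q : Ideal R, IsParameterIdeal Q ∧ Q ≤ I ∧ I ≠ Q ∧ I ^ 2 = Q * I) ∧
  Module.Free (R ⧸ I) I.Cotangent

end General

section SemigroupRing

variable (k : Type*) [Field k]

/-- The semigroup ring `k[[H]]` of `H ⊆ ℕ`: the power series with exponents in `H`. -/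
def semigroupRing (H : AddSubmonoid ℕ) : Subalgebra k k⟦X⟧ where
  carrier := {f | ∀ n, n ∉ H → PowerSeries.coeff n f = 0}
  mul_mem' := by
    intro f g hf hg n hn
    rw [PowerSeries.coeff_mul]
    refine Finset.sum_eq_zero fun p hp => ?_
    rw [Finset.HasAntidiagonal.mem_antidiagonal] at hp
    by_cases h1 : p.1 ∈ H
    · by_cases h2 : p.2 ∈ H
      · exact absurd (hp ▸ H.add_mem h1 h2) hn
      · rw [hg _ h2, mul_zero]
    · rw [hf _ h1, zero_mul]
  add_mem' := by
    intro f g hf hg n hn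
    rw [map_add, hf n hn, hg n hn, add_zero]
  algebraMap_mem' := by
    intro r n hn
    have h0 : n ≠ 0 := fun h => hn (h ▸ H.zero_mem)
    rw [PowerSeries.algebraMap_apply, Algebra.algebraMap_self, RingHom.id_apply,
      PowerSeries.coeff_C, if_neg h0]

variable {k}

theorem X_pow_mem {H : AddSubmonoid ℕ} {n : ℕ} (hn : n ∈ H) :
    (PowerSeries.X : k⟦X⟧) ^ n ∈ semigroupRing k H := by
  intro m hm
  rw [PowerSeries.coeff_X_pow, if_neg]
  rintro rfl
  exact hm hn

theorem inv_mem {H : AddSubmonoid ℕ} {f : k⟦X⟧} (hf : f ∈ semigroupRing k H)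
    (h0 : PowerSeries.constantCoeff f ≠ 0) : f⁻¹ ∈ semigroupRing k H := by
  intro n
  induction n using Nat.strong_induction_on with
  | _ n ih =>
    intro hn
    have hn0 : n ≠ 0 := fun h => hn (h ▸ H.zero_mem)
    have h1 : PowerSeries.coeff n (f * f⁻¹) = 0 := by
      rw [PowerSeries.mul_inv_cancel f h0, PowerSeries.coeff_one, if_neg hn0]
    rw [PowerSeries.coeff_mul, Finset.sum_eq_single (0, n)] at h1
    · rcases mul_eq_zero.mp h1 with h | h
      · exact absurd (by simpa using h) h0
      · exact h
    · intro p hp hne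
      rw [Finset.HasAntidiagonal.mem_antidiagonal] at hp
      by_cases hp1 : p.1 ∈ H
      · have hp2 : p.2 ∉ H := fun h => hn (hp ▸ H.add_mem hp1 h)
        have hlt : p.2 < n := by
          rcases Nat.eq_zero_or_pos p.1 with h | h
          · exact absurd (Prod.ext h (by simpa [h] using hp)) hne
          · omega
        rw [ih _ hlt hp2, mul_zero]
      · rw [hf _ hp1, zero_mul]
    · intro h
      simp at h

instance (H : AddSubmonoid ℕ) : IsLocalRing (semigroupRing k H) := by
  have : IsLocalHom (semigroupRing k H).val.toRingHom := by
    refine ⟨fun f hf => ?_⟩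
    have h0 : PowerSeries.constantCoeff (f : k⟦X⟧) ≠ 0 :=
      (PowerSeries.isUnit_iff_constantCoeff.mp hf).ne_zero
    refine IsUnit.of_mul_eq_one ⟨(f : k⟦X⟧)⁻¹, inv_mem f.2 h0⟩ ?_
    exact Subtype.ext (PowerSeries.mul_inv_cancel _ h0)
  exact (semigroupRing k H).val.toRingHom.domain_isLocalRing

/-- The set `v(A)` of orders of the nonzero elements of a subalgebra `A` of `k[[t]]`. -/
def valueSet (A : Subalgebra k k⟦X⟧) : Set ℕ :=
  {n | ∃ f ∈ A, f.order = n}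

/-- The ideal `I` of `A ⊆ k[[t]]` possesses the invariants `(a, b)`: `I = (f, g)` and `I ^ 2 = f I`
for some `f, g` in `I` of orders `a < b`, where `b - a` is not in the value semigroup `v(A)`. -/
def HasInvariants {A : Subalgebra k k⟦X⟧} (I : Ideal A) (a b : ℕ) : Prop :=
  ∃ f g : A, I = Ideal.span {f, g} ∧ I ^ 2 = Ideal.span {f} * I ∧
    (f : k⟦X⟧).order = a ∧ (g : k⟦X⟧).order = b ∧ a < b ∧ b - a ∉ valueSet A

end SemigroupRing

section FiveEleven

variable (k : Type*) [Field k]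

/-- The ring `A = k[[t^5, t^11]]`, the semigroup ring of the numerical semigroup `⟨5, 11⟩`. -/
abbrev A511 : Subalgebra k k⟦X⟧ := semigroupRing k (AddSubmonoid.closure {5, 11})

variable {k}

theorem mem_H (i j : ℕ) : i * 5 + j * 11 ∈ AddSubmonoid.closure ({5, 11} : Set ℕ) := by
  have h5 : 5 ∈ AddSubmonoid.closure ({5, 11} : Set ℕ) := AddSubmonoid.subset_closure (by simp)
  have h11 : 11 ∈ AddSubmonoid.closure ({5, 11} : Set ℕ) := AddSubmonoid.subset_closure (by simp)
  simpa using add_mem (nsmul_mem h5 i) (nsmul_mem h11 j)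

/-- `t^20 + 3ε t^21 + ε^2 t^22 + (2τ - 55ε^7) t^27 + δ t^33` as an element of `A`. -/
noncomputable def genF (δ ε τ : k) : A511 k :=
  ⟨PowerSeries.X ^ 20 + (3 * ε) • PowerSeries.X ^ 21 + (ε ^ 2) • PowerSeries.X ^ 22
      + (2 * τ - 55 * ε ^ 7) • PowerSeries.X ^ 27 + δ • PowerSeries.X ^ 33,
    add_mem (add_mem (add_mem (add_mem (X_pow_mem (mem_H 4 0))
      (Subalgebra.smul_mem _ (X_pow_mem (mem_H 2 1)) _))
      (Subalgebra.smul_mem _ (X_pow_mem (mem_H 0 2)) _))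
      (Subalgebra.smul_mem _ (X_pow_mem (mem_H 1 2)) _))
      (Subalgebra.smul_mem _ (X_pow_mem (mem_H 0 3)) _)⟩

/-- `t^26 + 2ε t^27 + τ t^33` as an element of `A`. -/
noncomputable def genG (ε τ : k) : A511 k :=
  ⟨PowerSeries.X ^ 26 + (2 * ε) • PowerSeries.X ^ 27 + τ • PowerSeries.X ^ 33,
    add_mem (add_mem (X_pow_mem (mem_H 3 1))
      (Subalgebra.smul_mem _ (X_pow_mem (mem_H 1 2)) _))
      (Subalgebra.smul_mem _ (X_pow_mem (mem_H 0 3)) _)⟩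

end FiveEleven

end UlrichIdeals

namespace UlrichIdeals

/-! ### The semigroup ⟨5, 11⟩ and membership in `A511 k`. -/

section Semigroup

/-! Write H = ⟨5, 11⟩; the power series of order at least 40 all lie in A. If I = (f, g) and I² = fI
with orders 20 and 26, multiplication by g/f maps I to itself and raises orders by 6, so I has
elements of every order in 20 + ⟨5, 6⟩. Hence t^40 k[[t]] ⊆ I, and modulo I only the ten exponents
0, 5, 10, 11, 15, 16, 21, 22, 27, 33 of H survive. This yields monic reduced generators F (`stdF`)
and G (`stdG`) with coefficients c₁, …, c₄ and d₁, d₂.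

Necessity (`exists_eq_span_gen`): K = G²/F = t^32 κ must lie in A and in I. The gaps of H above 32
are 34 and 39, so κ has no coefficient in degrees 2 and 7. Writing K = aF + bG and comparing
coefficients up to degree 33 shows that ε = c₁ - d₁ is nonzero, c₁ = 3ε and d₁ = 2ε; degree 34 gives
c₂ = ε², and degree 39 determines c₃.

Sufficiency: when ε ≠ 0, combinations of F and G with multipliers t^5 and t^11 again realise all
orders in 20 + ⟨5, 6⟩ (`exists_orders_span_std`), and reduction puts K in I (`exists_sq_eq_mul`).
Freeness of I/I² amounts to (F) : G ⊆ I (`mem_of_mul_eq`). This becomes a linear system in ten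
unknowns with blocks whose determinants are powers of ε up to sign, so the characteristic plays no
role. -/

theorem mem_closure_five_eleven_iff {n : ℕ} :
    n ∈ AddSubmonoid.closure ({5, 11} : Set ℕ) ↔ 11 * (n % 5) ≤ n := by
  constructor
  · intro h
    induction h using AddSubmonoid.closure_induction with
    | mem x hx => rcases hx with rfl | rfl <;> norm_num
    | zero => simp
    | add x y _ _ hx hy =>
      have h : (x + y) % 5 ≤ x % 5 + y % 5 := by
        rw [Nat.add_mod]
        exact Nat.mod_le _ _
      omega
  · intro h
    -- Since 11 ≡ 1 mod 5, the least element of H in the class r mod 5 is 11r.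
    have h1 : ((n - 11 * (n % 5)) / 5) * 5 + (n % 5) * 11 = n := by omega
    rw [← h1]
    exact mem_H _ _

variable {k : Type*} [Field k]

theorem mem_A511_iff {p : k⟦X⟧} :
    p ∈ A511 k ↔ ∀ n, n < 11 * (n % 5) → PowerSeries.coeff n p = 0 := by
  refine ⟨fun h n hn => h n ?_, fun h n hn => h n ?_⟩
  · rw [mem_closure_five_eleven_iff]; omega
  · rw [mem_closure_five_eleven_iff] at hn; omega

theorem coeff_eq_zero_of_gap (a : A511 k) {n : ℕ} (hn : n < 11 * (n % 5)) :
    PowerSeries.coeff n (a : k⟦X⟧) = 0 :=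
  mem_A511_iff.mp a.2 n hn

theorem mem_A511_of_coeff_lt {p : k⟦X⟧} (h : ∀ n < 40, PowerSeries.coeff n p = 0) :
    p ∈ A511 k :=
  mem_A511_iff.mpr fun n hn => h n (by omega)

theorem X_pow_mem_A511 {n : ℕ} (hn : 11 * (n % 5) ≤ n) :
    (PowerSeries.X : k⟦X⟧) ^ n ∈ A511 k :=
  X_pow_mem (mem_closure_five_eleven_iff.mpr hn)

/-- The monomial `t ^ n` of `A`, for `n` in the semigroup `⟨5, 11⟩`. -/
noncomputable def mon (k : Type*) [Field k] (n : ℕ) (hn : 11 * (n % 5) ≤ n) : A511 k :=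
  ⟨PowerSeries.X ^ n, X_pow_mem_A511 hn⟩

@[simp]
theorem coe_mon (n : ℕ) (hn : 11 * (n % 5) ≤ n) :
    (mon k n hn : k⟦X⟧) = PowerSeries.X ^ n := rfl

theorem mem_maximalIdeal_iff (a : A511 k) :
    a ∈ IsLocalRing.maximalIdeal (A511 k) ↔ PowerSeries.coeff 0 (a : k⟦X⟧) = 0 := by
  rw [IsLocalRing.mem_maximalIdeal, mem_nonunits_iff, not_iff_comm]
  constructor
  · intro h
    refine IsUnit.of_mul_eq_one ⟨(a : k⟦X⟧)⁻¹, inv_mem a.2 (by simpa using h)⟩ ?_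
    exact Subtype.ext (PowerSeries.mul_inv_cancel _ (by simpa using h))
  · intro h h0
    have h1 := h.map (A511 k).val
    have h2 := (PowerSeries.isUnit_iff_constantCoeff.mp h1).ne_zero
    exact h2 (by simpa using h0)

theorem isUnit_of_coeff_zero_ne {a : A511 k} (h : PowerSeries.coeff 0 (a : k⟦X⟧) ≠ 0) :
    IsUnit a := by
  by_contra h1
  exact h ((mem_maximalIdeal_iff a).mp h1)

end Semigroup

/-! ### The conductor, and reduction modulo an ideal with enough orders. -/

section Conductor

variable {k : Type*} [Field k]

/-- The conductor `t ^ 40 k[[t]]` of `A`. -/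
def conductor (k : Type*) [Field k] : Ideal (A511 k) where
  carrier := {p | ∀ n < 40, PowerSeries.coeff n (p : k⟦X⟧) = 0}
  add_mem' := by
    intro p q hp hq n hn
    simp [hp n hn, hq n hn]
  zero_mem' := by
    intro n _
    simp
  smul_mem' := by
    intro c p hp n hn
    have h1 : (PowerSeries.X : k⟦X⟧) ^ 40 ∣ p := PowerSeries.X_pow_dvd_iff.mpr hp
    exact PowerSeries.X_pow_dvd_iff.mp (h1.mul_left (c : k⟦X⟧)) n hn

theorem mem_conductor_iff {p : A511 k} :
    p ∈ conductor k ↔ ∀ n < 40, PowerSeries.coeff n (p : k⟦X⟧) = 0 := Iff.rfl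

/-- The part of a power series with exponents congruent to `m` modulo `5`, divided by `t ^ m`. -/
noncomputable def component (m : ℕ) (p : k⟦X⟧) : A511 k :=
  ⟨PowerSeries.mk fun n => if n % 5 = 0 then PowerSeries.coeff (n + m) p else 0,
    mem_A511_iff.mpr fun n hn => by
      rw [PowerSeries.coeff_mk, if_neg]
      omega⟩

/-- A contains k[[t^5]], so splitting exponents by residue mod 5 exhibits five generators of the
conductor. -/
theorem eq_sum_component {p : A511 k} (hp : p ∈ conductor k) :
    p = component 40 (p : k⟦X⟧) * mon k 40 (by norm_num)
      + component 41 (p : k⟦X⟧) * mon k 41 (by norm_num)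
      + component 42 (p : k⟦X⟧) * mon k 42 (by norm_num)
      + component 43 (p : k⟦X⟧) * mon k 43 (by norm_num)
      + component 44 (p : k⟦X⟧) * mon k 44 (by norm_num) := by
  apply Subtype.ext
  ext n
  simp only [Subalgebra.coe_add, Subalgebra.coe_mul, coe_mon, map_add,
    PowerSeries.coeff_mul_X_pow', component, PowerSeries.coeff_mk]
  by_cases h : n < 40
  · rw [hp n h]
    simp only [show ¬ 40 ≤ n by omega, show ¬ 41 ≤ n by omega, show ¬ 42 ≤ n by omega,
      show ¬ 43 ≤ n by omega, show ¬ 44 ≤ n by omega, if_false, add_zero]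
  · obtain ⟨m, rfl⟩ : ∃ m, n = m + 40 := ⟨n - 40, by omega⟩
    have key : ∀ i : ℕ, (if 40 + i ≤ m + 40 then
        (if (m + 40 - (40 + i)) % 5 = 0 then
          PowerSeries.coeff (m + 40 - (40 + i) + (40 + i)) (p : k⟦X⟧) else 0) else 0) =
        if i ≤ m ∧ (m - i) % 5 = 0 then PowerSeries.coeff (m + 40) (p : k⟦X⟧) else 0 := by
      intro i
      by_cases h1 : i ≤ m
      · rw [if_pos (by omega), show m + 40 - (40 + i) + (40 + i) = m + 40 by omega,
          show m + 40 - (40 + i) = m - i by omega]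
        simp [h1]
      · rw [if_neg (by omega), if_neg (by omega)]
    rw [key 0, key 1, key 2, key 3, key 4]
    have h5 : m % 5 < 5 := Nat.mod_lt _ (by norm_num)
    interval_cases h6 : m % 5
    · rw [if_pos (by omega), if_neg (by omega), if_neg (by omega), if_neg (by omega),
        if_neg (by omega)]; ring
    · rw [if_neg (by omega), if_pos (by omega), if_neg (by omega), if_neg (by omega),
        if_neg (by omega)]; ring
    · rw [if_neg (by omega), if_neg (by omega), if_pos (by omega), if_neg (by omega),
        if_neg (by omega)]; ring
    · rw [if_neg (by omega), if_neg (by omega), if_neg (by omega), if_pos (by omega),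
        if_neg (by omega)]; ring
    · rw [if_neg (by omega), if_neg (by omega), if_neg (by omega), if_neg (by omega),
        if_pos (by omega)]; ring

theorem mon_mem_conductor {n : ℕ} (h : 40 ≤ n) : mon k n (by omega) ∈ conductor k := by
  intro m hm
  rw [coe_mon, PowerSeries.coeff_X_pow, if_neg (by omega)]

theorem conductor_fg : (conductor k).FG := by
  classical
  refine ⟨{mon k 40 (by norm_num), mon k 41 (by norm_num), mon k 42 (by norm_num),
    mon k 43 (by norm_num), mon k 44 (by norm_num)}, le_antisymm ?_ ?_⟩
  · rw [Submodule.span_le]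
    intro p hp
    simp only [Finset.coe_insert, Finset.coe_singleton, Set.mem_insert_iff,
      Set.mem_singleton_iff] at hp
    rcases hp with rfl | rfl | rfl | rfl | rfl <;> exact mon_mem_conductor (by norm_num)
  · intro p hp
    rw [eq_sum_component hp]
    refine add_mem (add_mem (add_mem (add_mem ?_ ?_) ?_) ?_) ?_ <;>
      exact Ideal.mul_mem_left _ _ (Submodule.subset_span (by simp))

/-- Multiplication by a scalar stays in the ideal. -/
theorem smul_mem_ideal {I : Ideal (A511 k)} (c : k) {p : A511 k} (hp : p ∈ I) : c • p ∈ I := by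
  rw [Algebra.smul_def]
  exact I.mul_mem_left _ hp

/-- Cancel the coefficient at the order of `p`. -/
theorem exists_coeff_sub_smul_eq_zero {p : A511 k} {n : ℕ} (hp : (p : k⟦X⟧).order = n)
    (r : A511 k) : ∃ c : k, PowerSeries.coeff n ((r - c • p : A511 k) : k⟦X⟧) = 0 ∧
      ∀ m < n, PowerSeries.coeff m ((r - c • p : A511 k) : k⟦X⟧)
        = PowerSeries.coeff m (r : k⟦X⟧) := by
  obtain ⟨h1, h2⟩ := PowerSeries.order_eq_nat.mp hp
  refine ⟨PowerSeries.coeff n (r : k⟦X⟧) / PowerSeries.coeff n (p : k⟦X⟧), ?_, ?_⟩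
  · simp [div_mul_cancel₀ _ h1]
  · intro m hm
    simp [h2 m hm]

theorem exists_sub_mem_coeff_eq_zero {I : Ideal (A511 k)} (s : ℕ) (d : ℕ)
    (h : ∀ n, s ≤ n → n < s + d → ∃ p ∈ I, (p : k⟦X⟧).order = n) (r : A511 k)
    (hr : ∀ n < s, PowerSeries.coeff n (r : k⟦X⟧) = 0) :
    ∃ r' : A511 k, r - r' ∈ I ∧ ∀ n < s + d, PowerSeries.coeff n (r' : k⟦X⟧) = 0 := by
  induction d with
  | zero => exact ⟨r, by simp, hr⟩
  | succ d ih =>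
    obtain ⟨r', h1, h2⟩ := ih fun n hn hn' => h n hn (by omega)
    obtain ⟨p, hpI, hp⟩ := h (s + d) (by omega) (by omega)
    obtain ⟨c, h3, h4⟩ := exists_coeff_sub_smul_eq_zero hp r'
    refine ⟨r' - c • p, ?_, ?_⟩
    · have : r - (r' - c • p) = (r - r') + c • p := by ring
      rw [this]
      exact add_mem h1 (smul_mem_ideal c hpI)
    · intro n hn
      rcases Nat.lt_succ_iff_lt_or_eq.mp (show n < (s + d) + 1 by omega) with h5 | rfl
      · rw [h4 n h5, h2 n h5]
      · exact h3

/-- Nakayama replaces an infinite expansion: five leading terms can be cleared using I, and the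
remainder in t^45 k[[t]] is t^5 times an element of the conductor. -/
theorem conductor_le_of_orders {I : Ideal (A511 k)}
    (h : ∀ n : ℕ, 40 ≤ n → n < 45 → ∃ p ∈ I, (p : k⟦X⟧).order = n) : conductor k ≤ I := by
  refine Submodule.le_of_le_smul_of_le_jacobson_bot (I := IsLocalRing.maximalIdeal (A511 k))
    conductor_fg (IsLocalRing.maximalIdeal_le_jacobson _) ?_
  intro r hr
  obtain ⟨r', h1, h2⟩ := exists_sub_mem_coeff_eq_zero 40 5 h r hr
  have h3 : (PowerSeries.X : k⟦X⟧) ^ 45 ∣ r' := PowerSeries.X_pow_dvd_iff.mpr h2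
  obtain ⟨q, hq⟩ := h3
  have h4 : ∀ n < 40, PowerSeries.coeff n ((PowerSeries.X : k⟦X⟧) ^ 40 * q) = 0 :=
    PowerSeries.X_pow_dvd_iff.mp (dvd_mul_right _ _)
  have h5 : r' = mon k 5 (by norm_num) * ⟨_, mem_A511_of_coeff_lt h4⟩ := by
    apply Subtype.ext
    rw [Subalgebra.coe_mul, hq, coe_mon]
    ring
  rw [← sub_add_cancel r r']
  refine Submodule.add_mem_sup h1 ?_
  rw [h5]
  refine Submodule.smul_mem_smul ?_ h4
  rw [mem_maximalIdeal_iff]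
  simp [PowerSeries.coeff_X_pow]

/-- If `I` has elements of orders `20, 26, 32, 38, 44`, all elements of `20 + ⟨5, 6⟩` are orders
of elements of `I`. -/
theorem exists_order_eq {I : Ideal (A511 k)}
    (h : ∀ j < 5, ∃ p ∈ I, (p : k⟦X⟧).order = (20 + 6 * j : ℕ)) {n : ℕ}
    (hn : 20 + 6 * ((n - 20) % 5) ≤ n) : ∃ p ∈ I, (p : k⟦X⟧).order = n := by
  obtain ⟨p, hpI, hp⟩ := h ((n - 20) % 5) (Nat.mod_lt _ (by norm_num))
  obtain ⟨i, hi⟩ : ∃ i, n = 5 * i + (20 + 6 * ((n - 20) % 5)) :=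
    ⟨(n - (20 + 6 * ((n - 20) % 5))) / 5, by omega⟩
  refine ⟨mon k (5 * i) (by omega) * p, I.mul_mem_left _ hpI, ?_⟩
  rw [Subalgebra.coe_mul, PowerSeries.order_mul, hp, coe_mon, PowerSeries.order_X_pow]
  exact_mod_cast hi.symm

theorem conductor_le {I : Ideal (A511 k)}
    (h : ∀ j < 5, ∃ p ∈ I, (p : k⟦X⟧).order = (20 + 6 * j : ℕ)) : conductor k ≤ I :=
  conductor_le_of_orders fun n hn hn' => exists_order_eq h (by omega)

/-- Reduction modulo `I`, of the coefficients at the elements of `20 + ⟨5, 6⟩` from `s` on. -/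
theorem exists_reduced {I : Ideal (A511 k)}
    (h : ∀ j < 5, ∃ p ∈ I, (p : k⟦X⟧).order = (20 + 6 * j : ℕ)) (s : ℕ) (hs : s ≤ 40)
    (r : A511 k) :
    ∃ r' : A511 k, r - r' ∈ I ∧
      (∀ n < s, PowerSeries.coeff n (r' : k⟦X⟧) = PowerSeries.coeff n (r : k⟦X⟧)) ∧
      ∀ n, s ≤ n → 20 + 6 * ((n - 20) % 5) ≤ n → PowerSeries.coeff n (r' : k⟦X⟧) = 0 := by
  have key : ∀ d, ∃ r' : A511 k, r - r' ∈ I ∧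
      (∀ n < s, PowerSeries.coeff n (r' : k⟦X⟧) = PowerSeries.coeff n (r : k⟦X⟧)) ∧
      ∀ n, s ≤ n → n < s + d → 20 + 6 * ((n - 20) % 5) ≤ n →
        PowerSeries.coeff n (r' : k⟦X⟧) = 0 := by
    intro d
    induction d with
    | zero => exact ⟨r, by simp, fun _ _ => rfl, fun n _ _ => by omega⟩
    | succ d ih =>
      obtain ⟨r', h1, h2, h3⟩ := ih
      by_cases hd : 20 + 6 * ((s + d - 20) % 5) ≤ s + d
      · obtain ⟨p, hpI, hp⟩ := exists_order_eq h hd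
        obtain ⟨c, h4, h5⟩ := exists_coeff_sub_smul_eq_zero hp r'
        refine ⟨r' - c • p, ?_, ?_, ?_⟩
        · have : r - (r' - c • p) = (r - r') + c • p := by ring
          rw [this]
          exact add_mem h1 (smul_mem_ideal c hpI)
        · intro n hn
          rw [h5 n (by omega), h2 n hn]
        · intro n hn hn' hn2
          rcases Nat.lt_succ_iff_lt_or_eq.mp (show n < (s + d) + 1 by omega) with h6 | rfl
          · rw [h5 n h6, h3 n hn h6 hn2]
          · exact h4
      · refine ⟨r', h1, h2, fun n hn hn' hn2 => ?_⟩
        rcases Nat.lt_succ_iff_lt_or_eq.mp (show n < (s + d) + 1 by omega) with h6 | rfl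
        · exact h3 n hn h6 hn2
        · exact absurd hn2 hd
  obtain ⟨r', h1, h2, h3⟩ := key (40 - s)
  -- Finitely many clearing steps suffice, because the tail from degree 40 on lies in I and can be
  -- removed at once.
  let q : k⟦X⟧ := PowerSeries.mk fun n => if n < 40 then 0 else PowerSeries.coeff n (r' : k⟦X⟧)
  have hq : ∀ n < 40, PowerSeries.coeff n q = 0 := fun n hn => by
    simp [q, PowerSeries.coeff_mk, hn]
  have hqI : (⟨q, mem_A511_of_coeff_lt hq⟩ : A511 k) ∈ I :=
    conductor_le h (mem_conductor_iff.mpr hq)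
  refine ⟨r' - ⟨q, mem_A511_of_coeff_lt hq⟩, ?_, ?_, ?_⟩
  · rw [← sub_add]
    exact add_mem h1 hqI
  · intro n hn
    rw [Subalgebra.coe_sub, map_sub, hq n (by omega), sub_zero, h2 n hn]
  · intro n hn hn2
    rw [Subalgebra.coe_sub, map_sub]
    by_cases h6 : n < 40
    · rw [hq n h6, h3 n hn (by omega) hn2, sub_zero]
    · simp [q, PowerSeries.coeff_mk, h6]

end Conductor

/-! ### Generators in normal form and uniqueness of the parameters. -/

section NormalForm

variable {k : Type*} [Field k]

/-- `t^20 + c₁ t^21 + c₂ t^22 + c₃ t^27 + c₄ t^33` as an element of `A`. -/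
noncomputable def stdF (c₁ c₂ c₃ c₄ : k) : A511 k :=
  mon k 20 (by norm_num) + c₁ • mon k 21 (by norm_num) + c₂ • mon k 22 (by norm_num)
    + c₃ • mon k 27 (by norm_num) + c₄ • mon k 33 (by norm_num)

/-- `t^26 + d₁ t^27 + d₂ t^33` as an element of `A`. -/
noncomputable def stdG (d₁ d₂ : k) : A511 k :=
  mon k 26 (by norm_num) + d₁ • mon k 27 (by norm_num) + d₂ • mon k 33 (by norm_num)

theorem genF_eq (δ ε τ : k) :
    genF δ ε τ = stdF (3 * ε) (ε ^ 2) (2 * τ - 55 * ε ^ 7) δ := rfl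

theorem genG_eq (ε τ : k) : genG ε τ = stdG (2 * ε) τ := rfl

theorem coe_stdF (c₁ c₂ c₃ c₄ : k) : (stdF c₁ c₂ c₃ c₄ : k⟦X⟧) =
    PowerSeries.X ^ 20 + c₁ • PowerSeries.X ^ 21 + c₂ • PowerSeries.X ^ 22
      + c₃ • PowerSeries.X ^ 27 + c₄ • PowerSeries.X ^ 33 := rfl

theorem coe_stdG (d₁ d₂ : k) : (stdG d₁ d₂ : k⟦X⟧) =
    PowerSeries.X ^ 26 + d₁ • PowerSeries.X ^ 27 + d₂ • PowerSeries.X ^ 33 := rfl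

theorem coeff_comb (a b : A511 k) (c₁ c₂ c₃ c₄ d₁ d₂ : k) (n : ℕ) :
    PowerSeries.coeff n ((a * stdF c₁ c₂ c₃ c₄ + b * stdG d₁ d₂ : A511 k) : k⟦X⟧) =
      (if 20 ≤ n then PowerSeries.coeff (n - 20) (a : k⟦X⟧) else 0)
      + c₁ * (if 21 ≤ n then PowerSeries.coeff (n - 21) (a : k⟦X⟧) else 0)
      + c₂ * (if 22 ≤ n then PowerSeries.coeff (n - 22) (a : k⟦X⟧) else 0)
      + c₃ * (if 27 ≤ n then PowerSeries.coeff (n - 27) (a : k⟦X⟧) else 0)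
      + c₄ * (if 33 ≤ n then PowerSeries.coeff (n - 33) (a : k⟦X⟧) else 0)
      + ((if 26 ≤ n then PowerSeries.coeff (n - 26) (b : k⟦X⟧) else 0)
      + d₁ * (if 27 ≤ n then PowerSeries.coeff (n - 27) (b : k⟦X⟧) else 0)
      + d₂ * (if 33 ≤ n then PowerSeries.coeff (n - 33) (b : k⟦X⟧) else 0)) := by
  rw [Subalgebra.coe_add, Subalgebra.coe_mul, Subalgebra.coe_mul, coe_stdF, coe_stdG]
  simp only [mul_add, mul_smul_comm, map_add, PowerSeries.coeff_smul,
    PowerSeries.coeff_mul_X_pow', smul_eq_mul]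

/-- Up to degree 33, only exponents of a up to 13 and of b up to 7 contribute, and in those ranges H
has just 0, 5, 10, 11 and 0, 5. -/
theorem coeff_comb_values (a b : A511 k) (c₁ c₂ c₃ c₄ d₁ d₂ : k) {p : A511 k}
    (hp : p = a * stdF c₁ c₂ c₃ c₄ + b * stdG d₁ d₂) {a0 a5 a10 a11 b0 b5 : k}
    (ha0 : PowerSeries.coeff 0 (a : k⟦X⟧) = a0) (ha5 : PowerSeries.coeff 5 (a : k⟦X⟧) = a5)
    (ha10 : PowerSeries.coeff 10 (a : k⟦X⟧) = a10) (ha11 : PowerSeries.coeff 11 (a : k⟦X⟧) = a11)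
    (hb0 : PowerSeries.coeff 0 (b : k⟦X⟧) = b0) (hb5 : PowerSeries.coeff 5 (b : k⟦X⟧) = b5) :
    PowerSeries.coeff 20 (p : k⟦X⟧) = a0 ∧
    PowerSeries.coeff 21 (p : k⟦X⟧) = c₁ * a0 ∧
    PowerSeries.coeff 22 (p : k⟦X⟧) = c₂ * a0 ∧
    PowerSeries.coeff 25 (p : k⟦X⟧) = a5 ∧
    PowerSeries.coeff 26 (p : k⟦X⟧) = c₁ * a5 + b0 ∧
    PowerSeries.coeff 27 (p : k⟦X⟧) = c₂ * a5 + c₃ * a0 + d₁ * b0 ∧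
    PowerSeries.coeff 30 (p : k⟦X⟧) = a10 ∧
    PowerSeries.coeff 31 (p : k⟦X⟧) = a11 + c₁ * a10 + b5 ∧
    PowerSeries.coeff 32 (p : k⟦X⟧) = c₁ * a11 + c₂ * a10 + c₃ * a5 + d₁ * b5 ∧
    PowerSeries.coeff 33 (p : k⟦X⟧) = c₂ * a11 + c₄ * a0 + d₂ * b0 := by
  have gap : ∀ (q : A511 k) (n : ℕ), n < 11 * (n % 5) → PowerSeries.coeff n (q : k⟦X⟧) = 0 :=
    fun q n hn => coeff_eq_zero_of_gap q hn
  have g := fun q : A511 k => gap q 1 (by norm_num)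
  have g2 := fun q : A511 k => gap q 2 (by norm_num)
  have g3 := fun q : A511 k => gap q 3 (by norm_num)
  have g4 := fun q : A511 k => gap q 4 (by norm_num)
  have g6 := fun q : A511 k => gap q 6 (by norm_num)
  have g7 := fun q : A511 k => gap q 7 (by norm_num)
  have g8 := fun q : A511 k => gap q 8 (by norm_num)
  have g9 := fun q : A511 k => gap q 9 (by norm_num)
  have g12 := fun q : A511 k => gap q 12 (by norm_num)
  have g13 := fun q : A511 k => gap q 13 (by norm_num)
  subst hp
  simp only [coeff_comb]
  norm_num [g, g2, g3, g4, g6, g7, g8, g9, g12, g13, ha0, ha5, ha10, ha11, hb0, hb5,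
    -PowerSeries.coeff_zero_eq_constantCoeff]

/-- The ideals in normal form determine their parameters. -/
theorem span_gen_injective {δ ε τ δ' ε' τ' : k} (hε : ε ≠ 0)
    (h : Ideal.span {genF δ ε τ, genG ε τ} = Ideal.span {genF δ' ε' τ', genG ε' τ'}) :
    δ = δ' ∧ ε = ε' ∧ τ = τ' := by
  have hF : genF δ' ε' τ' ∈ Ideal.span {genF δ ε τ, genG ε τ} :=
    h ▸ Ideal.subset_span (by simp)
  have hG : genG ε' τ' ∈ Ideal.span {genF δ ε τ, genG ε τ} :=
    h ▸ Ideal.subset_span (by simp)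
  rw [genF_eq, genF_eq, genG_eq, Ideal.mem_span_pair] at hF
  rw [genG_eq, genF_eq, genG_eq, Ideal.mem_span_pair] at hG
  obtain ⟨a, b, hF⟩ := hF
  obtain ⟨a', b', hG⟩ := hG
  obtain ⟨f20, f21, f22, f25, f26, f27, f30, f31, f32, f33⟩ :=
    coeff_comb_values a b _ _ _ _ _ _ hF.symm rfl rfl rfl rfl rfl rfl
  obtain ⟨g20, g21, g22, g25, g26, g27, g30, g31, g32, g33⟩ :=
    coeff_comb_values a' b' _ _ _ _ _ _ hG.symm rfl rfl rfl rfl rfl rfl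
  simp only [coe_stdF, coe_stdG, map_add, PowerSeries.coeff_smul, PowerSeries.coeff_X_pow,
    smul_eq_mul] at f20 f21 f22 f25 f26 f27 f30 f31 f32 f33 g20 g21 g22 g25 g26 g27 g30 g31 g32 g33
  norm_num [-PowerSeries.coeff_zero_eq_constantCoeff] at f20 f21 f25 f26 f30 f31 f32 f33
  norm_num [-PowerSeries.coeff_zero_eq_constantCoeff] at g20 g25 g26 g27 g30 g31 g32 g33
  generalize PowerSeries.coeff 0 (a : k⟦X⟧) = a0 at *
  generalize PowerSeries.coeff 5 (a : k⟦X⟧) = a5 at *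
  generalize PowerSeries.coeff 10 (a : k⟦X⟧) = a10 at *
  generalize PowerSeries.coeff 11 (a : k⟦X⟧) = a11 at *
  generalize PowerSeries.coeff 0 (b : k⟦X⟧) = b0 at *
  generalize PowerSeries.coeff 5 (b : k⟦X⟧) = b5 at *
  generalize PowerSeries.coeff 0 (a' : k⟦X⟧) = a0' at *
  generalize PowerSeries.coeff 5 (a' : k⟦X⟧) = a5' at *
  generalize PowerSeries.coeff 10 (a' : k⟦X⟧) = a10' at *
  generalize PowerSeries.coeff 11 (a' : k⟦X⟧) = a11' at *
  generalize PowerSeries.coeff 0 (b' : k⟦X⟧) = b0' at *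
  generalize PowerSeries.coeff 5 (b' : k⟦X⟧) = b5' at *
  subst f20 f25 f30 g20 g25 g30
  have hb0 : b0 = 0 := by linear_combination -f26
  have hb0' : b0' = 1 := by linear_combination -g26
  subst hb0 hb0'
  -- Eliminating b5 between degrees 31 and 32 leaves (3ε - 2ε) a11 = 0.
  have ha11 : a11 = 0 := by
    have : ε * a11 = 0 := by linear_combination -f32 + 2 * ε * f31
    exact (mul_eq_zero.mp this).resolve_left hε
  have ha11' : a11' = 0 := by
    have : ε * a11' = 0 := by linear_combination -g32 + 2 * ε * g31
    exact (mul_eq_zero.mp this).resolve_left hε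
  subst ha11 ha11'
  refine ⟨?_, ?_, ?_⟩
  · linear_combination -f33
  -- Both 3ε = 3ε' and 2ε = 2ε' hold; their difference works in every characteristic.
  · linear_combination g27 - f21
  · linear_combination -g33

end NormalForm

/-! ### Independence of the choice of generators. -/

section Generators

variable {k : Type*} [Field k]

/-- If p ∈ I then gp ∈ I² = fI, so gp/f is again in I, with order larger by 6. -/
theorem exists_orders_of_sq_eq {I : Ideal (A511 k)} {f g : A511 k}
    (hf : f ∈ I) (hg : g ∈ I) (hI : I ^ 2 = Ideal.span {f} * I)
    (hfo : (f : k⟦X⟧).order = 20) (hgo : (g : k⟦X⟧).order = 26) (j : ℕ) :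
    ∃ p ∈ I, (p : k⟦X⟧).order = (20 + 6 * j : ℕ) := by
  induction j with
  | zero => exact ⟨f, hf, by simpa using hfo⟩
  | succ j ih =>
    obtain ⟨p, hp, hpo⟩ := ih
    have h1 : g * p ∈ Ideal.span {f} * I := by
      rw [← hI, sq]
      exact Ideal.mul_mem_mul hg hp
    obtain ⟨q, hq, hfq⟩ := Ideal.mem_span_singleton_mul.mp h1
    refine ⟨q, hq, ?_⟩
    have h2 := congrArg (fun z : A511 k => (z : k⟦X⟧).order) hfq
    simp only [Subalgebra.coe_mul, PowerSeries.order_mul, hfo, hgo, hpo] at h2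
    have h3 : (q : k⟦X⟧).order ≠ ⊤ := by
      intro h
      rw [h] at h2
      have : (26 + ((20 + 6 * j : ℕ) : ℕ∞)) ≠ ⊤ := by
        exact_mod_cast ENat.natCast_ne_top (26 + (20 + 6 * j))
      exact this (by rw [← h2]; rfl)
    obtain ⟨n, hn⟩ := ENat.ne_top_iff_exists.mp h3
    rw [← hn] at h2 ⊢
    have h4 : 20 + n = 26 + (20 + 6 * j) := by exact_mod_cast h2
    exact_mod_cast (by omega : n = 20 + 6 * (j + 1))

/-- The difference 26 - 20 = 6 is a gap of H: once the terms of `p` below degree 26 vanish, so do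
the coefficients of `a` in degrees 0 and 5, and `a * f` cannot reach degree 26. -/
theorem coeff_comb_low {f g : A511 k} (hfo : (f : k⟦X⟧).order = 20)
    (hgo : (g : k⟦X⟧).order = 26) {a b p : A511 k} (hp : a * f + b * g = p) :
    PowerSeries.coeff 20 (p : k⟦X⟧)
      = PowerSeries.coeff 0 (a : k⟦X⟧) * PowerSeries.coeff 20 (f : k⟦X⟧) ∧
    ((∀ n < 26, PowerSeries.coeff n (p : k⟦X⟧) = 0) → PowerSeries.coeff 0 (a : k⟦X⟧) = 0 ∧
      PowerSeries.coeff 26 (p : k⟦X⟧)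
        = PowerSeries.coeff 0 (b : k⟦X⟧) * PowerSeries.coeff 26 (g : k⟦X⟧)) := by
  obtain ⟨hf1, hf2⟩ := (PowerSeries.order_eq_nat (n := 20)).mp hfo
  obtain ⟨hg1, hg2⟩ := (PowerSeries.order_eq_nat (n := 26)).mp hgo
  obtain ⟨φ, hφ⟩ := PowerSeries.X_pow_dvd_iff.mpr hf2
  obtain ⟨γ, hγ⟩ := PowerSeries.X_pow_dvd_iff.mpr hg2
  have hp' : (p : k⟦X⟧) = ((a : k⟦X⟧) * φ) * PowerSeries.X ^ 20
      + ((b : k⟦X⟧) * γ) * PowerSeries.X ^ 26 := by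
    rw [← hp, Subalgebra.coe_add, Subalgebra.coe_mul, Subalgebra.coe_mul, hφ, hγ]
    ring
  have a1 := coeff_eq_zero_of_gap a (n := 1) (by norm_num)
  have a2 := coeff_eq_zero_of_gap a (n := 2) (by norm_num)
  have a3 := coeff_eq_zero_of_gap a (n := 3) (by norm_num)
  have a4 := coeff_eq_zero_of_gap a (n := 4) (by norm_num)
  have a6 := coeff_eq_zero_of_gap a (n := 6) (by norm_num)
  have hf20 : PowerSeries.coeff 20 (f : k⟦X⟧) = PowerSeries.coeff 0 φ := by
    rw [hφ, PowerSeries.coeff_X_pow_mul']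
    norm_num
  have hg26 : PowerSeries.coeff 26 (g : k⟦X⟧) = PowerSeries.coeff 0 γ := by
    rw [hγ, PowerSeries.coeff_X_pow_mul']
    norm_num
  rw [hf20] at hf1 ⊢
  rw [hg26] at hg1 ⊢
  have key : ∀ n, PowerSeries.coeff n (p : k⟦X⟧)
      = (if 20 ≤ n then PowerSeries.coeff (n - 20) ((a : k⟦X⟧) * φ) else 0)
      + (if 26 ≤ n then PowerSeries.coeff (n - 26) ((b : k⟦X⟧) * γ) else 0) := by
    intro n
    rw [hp', map_add, PowerSeries.coeff_mul_X_pow', PowerSeries.coeff_mul_X_pow']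
  have k20 : PowerSeries.coeff 20 (p : k⟦X⟧)
      = PowerSeries.coeff 0 (a : k⟦X⟧) * PowerSeries.coeff 0 φ := by
    rw [key]
    simp [PowerSeries.coeff_mul]
  refine ⟨k20, fun h => ?_⟩
  have ha0 : PowerSeries.coeff 0 (a : k⟦X⟧) = 0 := by
    rw [h 20 (by norm_num)] at k20
    exact (mul_eq_zero.mp k20.symm).resolve_right hf1
  have k25 := key 25
  rw [h 25 (by norm_num)] at k25
  have k26 := key 26
  simp [PowerSeries.coeff_mul, Finset.Nat.antidiagonal_succ, ha0, a1, a2, a3, a4, a6,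
    -PowerSeries.coeff_zero_eq_constantCoeff] at k25 k26
  have ha5 : PowerSeries.coeff 5 (a : k⟦X⟧) = 0 := by
    exact k25.resolve_right hf1
  rw [ha5] at k26
  exact ⟨ha0, by linear_combination k26⟩

/-- Modulo the maximal ideal the transition matrix is triangular with nonzero diagonal, hence
invertible over A. -/
theorem span_pair_eq_of_orders {I : Ideal (A511 k)} {f g F G : A511 k}
    (hfg : I = Ideal.span {f, g})
    (hfo : (f : k⟦X⟧).order = 20) (hgo : (g : k⟦X⟧).order = 26)
    (hF : F ∈ I) (hG : G ∈ I)
    (hFo : (F : k⟦X⟧).order = 20) (hGo : (G : k⟦X⟧).order = 26) :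
    I = Ideal.span {F, G} := by
  obtain ⟨hF1, hF2⟩ := (PowerSeries.order_eq_nat (n := 20)).mp hFo
  obtain ⟨hG1, hG2⟩ := (PowerSeries.order_eq_nat (n := 26)).mp hGo
  obtain ⟨u, w, huw⟩ := Ideal.mem_span_pair.mp (hfg ▸ hF)
  obtain ⟨u', w', huw'⟩ := Ideal.mem_span_pair.mp (hfg ▸ hG)
  have hu := (coeff_comb_low hfo hgo huw).1
  obtain ⟨hu', hw'⟩ := (coeff_comb_low hfo hgo huw').2 hG2
  have hu0 : PowerSeries.coeff 0 (u : k⟦X⟧) ≠ 0 := fun h => hF1 (by rw [hu, h, zero_mul])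
  have hw0 : PowerSeries.coeff 0 (w' : k⟦X⟧) ≠ 0 := fun h => hG1 (by rw [hw', h, zero_mul])
  have hD : IsUnit (u * w' - w * u') := by
    refine isUnit_of_coeff_zero_ne ?_
    simp only [PowerSeries.coeff_zero_eq_constantCoeff] at hu0 hw0 hu'
    simpa [hu'] using ⟨hu0, hw0⟩
  obtain ⟨v, hv⟩ := hD.exists_right_inv
  apply le_antisymm
  · rw [hfg, Ideal.span_le]
    rintro z (rfl | rfl)
    · refine Ideal.mem_span_pair.mpr ⟨v * w', - v * w, ?_⟩
      rw [← huw, ← huw']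
      linear_combination z * hv
    · refine Ideal.mem_span_pair.mpr ⟨- v * u', v * u, ?_⟩
      rw [← huw, ← huw']
      linear_combination z * hv
  · rw [Ideal.span_le]
    rintro z (rfl | rfl)
    · exact hF
    · exact hG

/-- With F = uf + wg and g² = f(af + bg), multiplication of (f, g) by F is f times the matrix with
rows (u, w) and (wa, u + wb). Its determinant is a unit because u is a unit and a, b are not. -/
theorem sq_eq_of_orders {I : Ideal (A511 k)} {f g F : A511 k}
    (hfg : I = Ideal.span {f, g}) (hI : I ^ 2 = Ideal.span {f} * I)
    (hfo : (f : k⟦X⟧).order = 20) (hgo : (g : k⟦X⟧).order = 26)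
    (hF : F ∈ I) (hFo : (F : k⟦X⟧).order = 20) : I ^ 2 = Ideal.span {F} * I := by
  have hgI : g ∈ I := hfg ▸ Ideal.subset_span (by simp)
  have hfI : f ∈ I := hfg ▸ Ideal.subset_span (by simp)
  obtain ⟨hF1, hF2⟩ := (PowerSeries.order_eq_nat (n := 20)).mp hFo
  obtain ⟨u, w, huw⟩ := Ideal.mem_span_pair.mp (hfg ▸ hF)
  have hu := (coeff_comb_low hfo hgo huw).1
  have hu0 : PowerSeries.coeff 0 (u : k⟦X⟧) ≠ 0 := fun h => hF1 (by rw [hu, h, zero_mul])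
  have hgg : g * g ∈ Ideal.span {f} * I := by
    rw [← hI, sq]
    exact Ideal.mul_mem_mul hgI hgI
  obtain ⟨K, hK, hfK⟩ := Ideal.mem_span_singleton_mul.mp hgg
  -- The order of K is 2 · 26 - 20 = 32; any bound above 26 is enough to make a and b nonunits.
  have hKo : (PowerSeries.X : k⟦X⟧) ^ 27 ∣ K := by
    have h1 : (PowerSeries.X : k⟦X⟧) ^ 26 ∣ g :=
      PowerSeries.X_pow_dvd_iff.mpr ((PowerSeries.order_eq_nat (n := 26)).mp hgo).2
    obtain ⟨φ, hφ⟩ := PowerSeries.X_pow_dvd_iff.mpr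
      ((PowerSeries.order_eq_nat (n := 20)).mp hfo).2
    have h2 : PowerSeries.coeff 0 φ ≠ 0 := by
      have := ((PowerSeries.order_eq_nat (n := 20)).mp hfo).1
      rw [hφ, PowerSeries.coeff_X_pow_mul'] at this
      simpa using this
    have h3 : (PowerSeries.X : k⟦X⟧) ^ 52 ∣ (f : k⟦X⟧) * K := by
      have := congrArg (fun z : A511 k => (z : k⟦X⟧)) hfK
      simp only [Subalgebra.coe_mul] at this
      rw [this]
      have h12 := mul_dvd_mul h1 h1
      rwa [← pow_add] at h12
    have h4 : (PowerSeries.X : k⟦X⟧) ^ 32 ∣ φ * K := by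
      rw [hφ, show (52 : ℕ) = 20 + 32 by norm_num, pow_add, mul_assoc] at h3
      exact (mul_dvd_mul_iff_left (pow_ne_zero 20 PowerSeries.X_ne_zero)).mp h3
    have h5 : (K : k⟦X⟧) = φ⁻¹ * (φ * K) := by
      rw [← mul_assoc, PowerSeries.inv_mul_cancel _ (by simpa using h2), one_mul]
    rw [h5]
    exact (pow_dvd_pow _ (by norm_num)).trans (h4.mul_left _)
  have hK0 := PowerSeries.X_pow_dvd_iff.mp hKo
  obtain ⟨a, b, hab⟩ := Ideal.mem_span_pair.mp (hfg ▸ hK)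
  obtain ⟨ha, hb⟩ := (coeff_comb_low hfo hgo hab).2 fun n hn => hK0 n (by omega)
  have hb0 : PowerSeries.coeff 0 (b : k⟦X⟧) = 0 := by
    rw [hK0 26 (by norm_num)] at hb
    exact (mul_eq_zero.mp hb.symm).resolve_right
      ((PowerSeries.order_eq_nat (n := 26)).mp hgo).1
  have hD : IsUnit (u * (u + w * b) - w * (w * a)) := by
    refine isUnit_of_coeff_zero_ne ?_
    simp only [PowerSeries.coeff_zero_eq_constantCoeff] at hu0 ha hb0
    simpa [ha, hb0] using hu0
  obtain ⟨v, hv⟩ := hD.exists_right_inv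
  apply le_antisymm
  · intro z hz
    rw [hI] at hz
    obtain ⟨P, hP, hfP⟩ := Ideal.mem_span_singleton_mul.mp hz
    obtain ⟨p, q, hpq⟩ := Ideal.mem_span_pair.mp (hfg ▸ hP)
    refine Ideal.mem_span_singleton_mul.mpr
      ⟨v * (p * (u + w * b) - w * a * q) * f + v * (u * q - w * p) * g,
        add_mem (I.mul_mem_left _ hfI) (I.mul_mem_left _ hgI), ?_⟩
    rw [← hfP, ← hpq, ← huw]
    rw [← hab] at hfK
    linear_combination (f * (p * f + q * g)) * hv - v * (u * q - w * p) * w * hfK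
  · rw [sq]
    exact Ideal.mul_mono_left ((Ideal.span_singleton_le_iff_mem _).mpr hF)

end Generators

/-! ### The invariants force the normal form. -/

section Necessity

variable {k : Type*} [Field k]

/-- The unit part of `stdF`. -/
noncomputable def unitF (c₁ c₂ c₃ c₄ : k) : k⟦X⟧ :=
  1 + c₁ • PowerSeries.X ^ 1 + c₂ • PowerSeries.X ^ 2
    + c₃ • PowerSeries.X ^ 7 + c₄ • PowerSeries.X ^ 13

/-- The unit part of `stdG`. -/
noncomputable def unitG (d₁ d₂ : k) : k⟦X⟧ :=
  1 + d₁ • PowerSeries.X ^ 1 + d₂ • PowerSeries.X ^ 7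

theorem coe_stdF_eq_mul (c₁ c₂ c₃ c₄ : k) :
    (stdF c₁ c₂ c₃ c₄ : k⟦X⟧) = PowerSeries.X ^ 20 * unitF c₁ c₂ c₃ c₄ := by
  simp only [coe_stdF, unitF, mul_add, mul_smul_comm, ← pow_add, mul_one]

theorem coe_stdG_eq_mul (d₁ d₂ : k) :
    (stdG d₁ d₂ : k⟦X⟧) = PowerSeries.X ^ 26 * unitG d₁ d₂ := by
  simp only [coe_stdG, unitG, mul_add, mul_smul_comm, ← pow_add, mul_one]

theorem constantCoeff_unitF (c₁ c₂ c₃ c₄ : k) :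
    PowerSeries.constantCoeff (unitF c₁ c₂ c₃ c₄) = 1 := by
  simp [unitF]

theorem constantCoeff_unitG (d₁ d₂ : k) : PowerSeries.constantCoeff (unitG d₁ d₂) = 1 := by
  simp [unitG]

theorem order_of_eq_X_pow_mul {p φ : k⟦X⟧} {n : ℕ} (h : p = PowerSeries.X ^ n * φ)
    (hφ : PowerSeries.constantCoeff φ ≠ 0) : p.order = n := by
  rw [h, PowerSeries.order_eq_nat]
  refine ⟨?_, PowerSeries.X_pow_dvd_iff.mp (dvd_mul_right _ _)⟩
  rw [PowerSeries.coeff_X_pow_mul']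
  simpa using hφ

theorem order_stdF (c₁ c₂ c₃ c₄ : k) : (stdF c₁ c₂ c₃ c₄ : k⟦X⟧).order = 20 :=
  order_of_eq_X_pow_mul (coe_stdF_eq_mul c₁ c₂ c₃ c₄) (by simp [constantCoeff_unitF])

theorem order_stdG (d₁ d₂ : k) : (stdG d₁ d₂ : k⟦X⟧).order = 26 :=
  order_of_eq_X_pow_mul (coe_stdG_eq_mul d₁ d₂) (by simp [constantCoeff_unitG])

theorem coeff_mul_unitF (p : k⟦X⟧) (c₁ c₂ c₃ c₄ : k) (n : ℕ) :
    PowerSeries.coeff n (p * unitF c₁ c₂ c₃ c₄) = PowerSeries.coeff n p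
      + c₁ * (if 1 ≤ n then PowerSeries.coeff (n - 1) p else 0)
      + c₂ * (if 2 ≤ n then PowerSeries.coeff (n - 2) p else 0)
      + c₃ * (if 7 ≤ n then PowerSeries.coeff (n - 7) p else 0)
      + c₄ * (if 13 ≤ n then PowerSeries.coeff (n - 13) p else 0) := by
  simp only [unitF, mul_add, mul_smul_comm, map_add, PowerSeries.coeff_smul,
    PowerSeries.coeff_mul_X_pow', smul_eq_mul, mul_one]

theorem coeff_unitG (d₁ d₂ : k) (n : ℕ) : PowerSeries.coeff n (unitG d₁ d₂) =
    (if n = 0 then 1 else 0) + d₁ * (if n = 1 then 1 else 0) + d₂ * (if n = 7 then 1 else 0) := by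
  simp only [unitG, map_add, PowerSeries.coeff_smul, PowerSeries.coeff_one,
    PowerSeries.coeff_X_pow, smul_eq_mul]

theorem coeff_unitG_sq (d₁ d₂ : k) (n : ℕ) : PowerSeries.coeff n (unitG d₁ d₂ * unitG d₁ d₂) =
    PowerSeries.coeff n (unitG d₁ d₂)
      + d₁ * (if 1 ≤ n then PowerSeries.coeff (n - 1) (unitG d₁ d₂) else 0)
      + d₂ * (if 7 ≤ n then PowerSeries.coeff (n - 7) (unitG d₁ d₂) else 0) := by
  conv_lhs => rw [show unitG d₁ d₂ * unitG d₁ d₂ = unitG d₁ d₂ *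
    (1 + d₁ • PowerSeries.X ^ 1 + d₂ • PowerSeries.X ^ 7) from rfl]
  simp only [mul_add, mul_smul_comm, map_add, PowerSeries.coeff_smul,
    PowerSeries.coeff_mul_X_pow', smul_eq_mul, mul_one]

/-- The first coefficients of `G ^ 2 / F`, up to the factor `t ^ 32`. -/
theorem coeff_sq_div {κ : k⟦X⟧} {c₁ c₂ c₃ c₄ d₁ d₂ : k}
    (h : κ * unitF c₁ c₂ c₃ c₄ = unitG d₁ d₂ * unitG d₁ d₂) :
    PowerSeries.coeff 0 κ = 1 ∧ PowerSeries.coeff 1 κ = 2 * d₁ - c₁ ∧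
    PowerSeries.coeff 2 κ = (d₁ - c₁) ^ 2 - c₂ ∧
    (∀ ε, c₁ = 3 * ε → c₂ = ε ^ 2 → d₁ = 2 * ε →
      PowerSeries.coeff 7 κ = 2 * d₂ - 55 * ε ^ 7 - c₃) := by
  have key := fun n => congrArg (PowerSeries.coeff n) h
  simp only [coeff_mul_unitF, coeff_unitG_sq, coeff_unitG] at key
  have h0 := key 0
  have h1 := key 1
  have h2 := key 2
  have h3 := key 3
  have h4 := key 4
  have h5 := key 5
  have h6 := key 6
  have h7 := key 7
  norm_num [-PowerSeries.coeff_zero_eq_constantCoeff] at h0 h1 h2 h3 h4 h5 h6 h7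
  refine ⟨h0, by linear_combination h1 - c₁ * h0,
    by linear_combination h2 - c₁ * (h1 - c₁ * h0) - c₂ * h0, ?_⟩
  -- Below degree 7, κ agrees with (1 + 2εt)²/(1 + 3εt + ε²t²), whose coefficients from degree 3 on
  -- are the alternating Fibonacci numbers 1, 3, 8, 21, 55 times powers of ε. This is the source of
  -- the constant 55.
  rintro ε rfl rfl rfl
  rw [h0] at h1 h2 h7
  have e1 : PowerSeries.coeff 1 κ = ε := by linear_combination h1
  rw [e1] at h2 h3
  have e2 : PowerSeries.coeff 2 κ = 0 := by linear_combination h2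
  rw [e2] at h3 h4
  have e3 : PowerSeries.coeff 3 κ = - ε ^ 3 := by linear_combination h3
  rw [e3] at h4 h5
  have e4 : PowerSeries.coeff 4 κ = 3 * ε ^ 4 := by linear_combination h4
  rw [e4] at h5 h6
  have e5 : PowerSeries.coeff 5 κ = - 8 * ε ^ 5 := by linear_combination h5
  rw [e5] at h6 h7
  have e6 : PowerSeries.coeff 6 κ = 21 * ε ^ 6 := by linear_combination h6
  rw [e6] at h7
  linear_combination h7

theorem exists_eq_X_pow_mul_of_sq {K : k⟦X⟧} {c₁ c₂ c₃ c₄ d₁ d₂ : k}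
    (h : (stdF c₁ c₂ c₃ c₄ : k⟦X⟧) * K = (stdG d₁ d₂ : k⟦X⟧) * stdG d₁ d₂) :
    ∃ κ, K = PowerSeries.X ^ 32 * κ ∧
      κ * unitF c₁ c₂ c₃ c₄ = unitG d₁ d₂ * unitG d₁ d₂ := by
  have hu := constantCoeff_unitF c₁ c₂ c₃ c₄
  have hF : (stdF c₁ c₂ c₃ c₄ : k⟦X⟧) ≠ 0 := fun h0 => by
    have := order_stdF c₁ c₂ c₃ c₄
    rw [h0, PowerSeries.order_zero] at this
    exact absurd this (by decide)
  refine ⟨unitG d₁ d₂ * unitG d₁ d₂ * (unitF c₁ c₂ c₃ c₄)⁻¹, mul_left_cancel₀ hF ?_, ?_⟩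
  · rw [h, coe_stdF_eq_mul, coe_stdG_eq_mul]
    have := PowerSeries.mul_inv_cancel (unitF c₁ c₂ c₃ c₄) (by rw [hu]; exact one_ne_zero)
    linear_combination (- PowerSeries.X ^ 52 * unitG d₁ d₂ * unitG d₁ d₂) * this
  · rw [mul_assoc, PowerSeries.inv_mul_cancel _ (by rw [hu]; exact one_ne_zero), mul_one]

/-- Above 20, the elements of H outside 20 + ⟨5, 6⟩ are exactly 21, 22, 27, 33. -/
theorem exists_eq_stdF {r : A511 k} (h1 : ∀ n < 20, PowerSeries.coeff n (r : k⟦X⟧) = 0)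
    (h2 : PowerSeries.coeff 20 (r : k⟦X⟧) = 1)
    (h3 : ∀ n, 21 ≤ n → 20 + 6 * ((n - 20) % 5) ≤ n → PowerSeries.coeff n (r : k⟦X⟧) = 0) :
    ∃ c₁ c₂ c₃ c₄ : k, r = stdF c₁ c₂ c₃ c₄ := by
  refine ⟨PowerSeries.coeff 21 (r : k⟦X⟧), PowerSeries.coeff 22 (r : k⟦X⟧),
    PowerSeries.coeff 27 (r : k⟦X⟧), PowerSeries.coeff 33 (r : k⟦X⟧), Subtype.ext ?_⟩
  ext n
  simp only [coe_stdF, map_add, PowerSeries.coeff_smul, PowerSeries.coeff_X_pow, smul_eq_mul]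
  by_cases h : n = 20 ∨ n = 21 ∨ n = 22 ∨ n = 27 ∨ n = 33
  · rcases h with rfl | rfl | rfl | rfl | rfl <;> simp [h2]
  · push Not at h
    obtain ⟨g1, g2, g3, g4, g5⟩ := h
    rw [if_neg g1, if_neg g2, if_neg g3, if_neg g4, if_neg g5]
    simp only [mul_zero, add_zero]
    rcases lt_or_ge n 20 with h6 | h6
    · exact h1 n h6
    · by_cases h7 : 20 + 6 * ((n - 20) % 5) ≤ n
      · exact h3 n (by omega) h7
      · exact coeff_eq_zero_of_gap r (by omega)

theorem exists_eq_stdG {r : A511 k} (h1 : ∀ n < 26, PowerSeries.coeff n (r : k⟦X⟧) = 0)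
    (h2 : PowerSeries.coeff 26 (r : k⟦X⟧) = 1)
    (h3 : ∀ n, 27 ≤ n → 20 + 6 * ((n - 20) % 5) ≤ n → PowerSeries.coeff n (r : k⟦X⟧) = 0) :
    ∃ d₁ d₂ : k, r = stdG d₁ d₂ := by
  refine ⟨PowerSeries.coeff 27 (r : k⟦X⟧), PowerSeries.coeff 33 (r : k⟦X⟧), Subtype.ext ?_⟩
  ext n
  simp only [coe_stdG, map_add, PowerSeries.coeff_smul, PowerSeries.coeff_X_pow, smul_eq_mul]
  by_cases h : n = 26 ∨ n = 27 ∨ n = 33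
  · rcases h with rfl | rfl | rfl <;> simp [h2]
  · push Not at h
    obtain ⟨g1, g2, g3⟩ := h
    rw [if_neg g1, if_neg g2, if_neg g3]
    simp only [mul_zero, add_zero]
    rcases lt_or_ge n 26 with h6 | h6
    · exact h1 n h6
    · by_cases h7 : 20 + 6 * ((n - 20) % 5) ≤ n
      · exact h3 n (by omega) h7
      · exact coeff_eq_zero_of_gap r (by omega)

/-- An element of order `m` in `I` can be made monic and reduced. -/
theorem exists_monic_reduced {I : Ideal (A511 k)}
    (h : ∀ j < 5, ∃ p ∈ I, (p : k⟦X⟧).order = (20 + 6 * j : ℕ)) {m : ℕ} (hm : m < 40)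
    {f : A511 k} (hf : f ∈ I) (hfo : (f : k⟦X⟧).order = m) :
    ∃ r ∈ I, (∀ n < m, PowerSeries.coeff n (r : k⟦X⟧) = 0) ∧
      PowerSeries.coeff m (r : k⟦X⟧) = 1 ∧
      ∀ n, m + 1 ≤ n → 20 + 6 * ((n - 20) % 5) ≤ n → PowerSeries.coeff n (r : k⟦X⟧) = 0 := by
  obtain ⟨h1, h2⟩ := PowerSeries.order_eq_nat.mp hfo
  have h3 : (PowerSeries.coeff m (f : k⟦X⟧))⁻¹ • f ∈ I := smul_mem_ideal _ hf
  obtain ⟨r, h4, h5, h6⟩ := exists_reduced h (m + 1) (by omega)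
    ((PowerSeries.coeff m (f : k⟦X⟧))⁻¹ • f)
  refine ⟨r, (Submodule.sub_mem_iff_right I h3).mp h4, fun n hn => ?_, ?_, h6⟩
  · rw [h5 n (by omega)]
    simp [h2 n hn]
  · rw [h5 m (by omega)]
    simp [h1]

theorem exists_eq_span_gen {I : Ideal (A511 k)} (hI : HasInvariants I 20 26) :
    ∃ δ ε τ : k, ε ≠ 0 ∧ I = Ideal.span {genF δ ε τ, genG ε τ} := by
  obtain ⟨f, g, hfg, hsq, hfo, hgo, -, -⟩ := hI
  replace hfo : (f : k⟦X⟧).order = 20 := hfo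
  replace hgo : (g : k⟦X⟧).order = 26 := hgo
  have hfI : f ∈ I := hfg ▸ Ideal.subset_span (by simp)
  have hgI : g ∈ I := hfg ▸ Ideal.subset_span (by simp)
  have hord : ∀ j < 5, ∃ p ∈ I, (p : k⟦X⟧).order = (20 + 6 * j : ℕ) :=
    fun j _ => exists_orders_of_sq_eq hfI hgI hsq hfo hgo j
  obtain ⟨F, hF, F1, F2, F3⟩ := exists_monic_reduced hord (m := 20) (by norm_num) hfI hfo
  obtain ⟨G, hG, G1, G2, G3⟩ := exists_monic_reduced hord (m := 26) (by norm_num) hgI hgo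
  obtain ⟨c₁, c₂, c₃, c₄, rfl⟩ := exists_eq_stdF F1 F2 F3
  obtain ⟨d₁, d₂, rfl⟩ := exists_eq_stdG G1 G2 G3
  have hspan := span_pair_eq_of_orders hfg hfo hgo hF hG (order_stdF ..) (order_stdG ..)
  have hsq' := sq_eq_of_orders hfg hsq hfo hgo hF (order_stdF ..)
  have hGG : stdG d₁ d₂ * stdG d₁ d₂ ∈ Ideal.span {stdF c₁ c₂ c₃ c₄} * I := by
    rw [← hsq', sq]
    exact Ideal.mul_mem_mul hG hG
  obtain ⟨K, hK, hFK⟩ := Ideal.mem_span_singleton_mul.mp hGG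
  obtain ⟨κ, hκ, hκF⟩ := exists_eq_X_pow_mul_of_sq (congrArg (fun z : A511 k => (z : k⟦X⟧)) hFK)
  obtain ⟨κ0, κ1, κ2, κ7⟩ := coeff_sq_div hκF
  obtain ⟨a, b, hab⟩ := Ideal.mem_span_pair.mp (hspan ▸ hK)
  obtain ⟨f20, f21, f22, f25, f26, f27, f30, f31, f32, f33⟩ :=
    coeff_comb_values a b _ _ _ _ _ _ hab.symm rfl rfl rfl rfl rfl rfl
  have f34 := coeff_eq_zero_of_gap K (n := 34) (by norm_num)
  have f39 := coeff_eq_zero_of_gap K (n := 39) (by norm_num)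
  simp only [hκ, PowerSeries.coeff_X_pow_mul'] at f20 f25 f26 f30 f31 f32 f33 f34 f39
  norm_num [-PowerSeries.coeff_zero_eq_constantCoeff] at f20 f25 f26 f30 f31 f32 f33 f34 f39
  rw [κ0] at f32
  rw [κ1] at f33
  rw [κ2] at f34
  rw [← f25, ← f30] at f32
  rw [← f25] at f26
  rw [← f20] at f33
  rw [← f30] at f31
  generalize PowerSeries.coeff 11 (a : k⟦X⟧) = e at *
  generalize PowerSeries.coeff 0 (b : k⟦X⟧) = b0 at *
  generalize PowerSeries.coeff 5 (b : k⟦X⟧) = b5 at *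
  -- Degree 31 gives b5 = -e, so the leading coefficient 1 of K in degree 32 is e(c₁ - d₁); hence ε
  -- will be nonzero.
  have he : e * (c₁ - d₁) = 1 := by linear_combination -f32 + d₁ * f31
  have hc2 : c₂ = (c₁ - d₁) ^ 2 := by linear_combination -f34
  have hd : 2 * d₁ - c₁ = c₁ - d₁ := by
    linear_combination f33 - d₂ * f26 + e * hc2 + (c₁ - d₁) * he
  obtain ⟨ε, hε⟩ : ∃ ε, ε = c₁ - d₁ := ⟨_, rfl⟩
  have h1 : c₁ = 3 * ε := by linear_combination -3 * hε + hd
  have h2 : d₁ = 2 * ε := by linear_combination -2 * hε + hd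
  have h3 : c₂ = ε ^ 2 := by rw [hc2, hε]
  have h7 := κ7 ε h1 h3 h2
  rw [f39] at h7
  refine ⟨c₄, ε, d₂, ?_, ?_⟩
  · rintro rfl
    rw [← hε, mul_zero] at he
    exact zero_ne_one he
  · rw [hspan, genF_eq, genG_eq, ← h1, ← h2, ← h3]
    congr 3
    linear_combination h7

end Necessity

/-! ### The normal forms satisfy I² = FI. -/

section Sufficiency

variable {k : Type*} [Field k]

/-- Since 5 + 26 = 11 + 20, leading terms cancel in t^11 F - t^5 G, which starts with ε t^32.
Repeating the cancellation with a factor ε gives ε² t^38 and ε³ t^44. -/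
theorem exists_orders_span_std {ε : k} (hε : ε ≠ 0) (c₃ c₄ τ : k) (j : ℕ) (hj : j < 5) :
    ∃ p ∈ Ideal.span {stdF (3 * ε) (ε ^ 2) c₃ c₄, stdG (2 * ε) τ},
      (p : k⟦X⟧).order = (20 + 6 * j : ℕ) := by
  set F := stdF (3 * ε) (ε ^ 2) c₃ c₄ with hF
  set G := stdG (2 * ε) τ with hG
  have hFI : F ∈ Ideal.span {F, G} := Ideal.subset_span (by simp)
  have hGI : G ∈ Ideal.span {F, G} := Ideal.subset_span (by simp)
  set E := mon k 11 (by norm_num) * F - mon k 5 (by norm_num) * G with hE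
  have hEI : E ∈ Ideal.span {F, G} :=
    sub_mem (Ideal.mul_mem_left _ _ hFI) (Ideal.mul_mem_left _ _ hGI)
  set D := ε • (mon k 11 (by norm_num) * G) - mon k 5 (by norm_num) * E with hD
  have hDI : D ∈ Ideal.span {F, G} :=
    sub_mem (smul_mem_ideal _ (Ideal.mul_mem_left _ _ hGI)) (Ideal.mul_mem_left _ _ hEI)
  interval_cases j
  · exact ⟨F, hFI, order_stdF ..⟩
  · exact ⟨G, hGI, order_stdG ..⟩
  · refine ⟨E, hEI, order_of_eq_X_pow_mul (φ := PowerSeries.C ε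
      + PowerSeries.C (ε ^ 2) * PowerSeries.X + PowerSeries.C (c₃ - τ) * PowerSeries.X ^ 6
      + PowerSeries.C c₄ * PowerSeries.X ^ 12) ?_ (by simpa using hε)⟩
    simp only [hE, hF, hG, Subalgebra.coe_sub, Subalgebra.coe_mul, coe_mon, coe_stdF, coe_stdG,
      PowerSeries.smul_eq_C_mul, map_mul, map_pow, map_sub, map_ofNat]
    ring
  · refine ⟨D, hDI, order_of_eq_X_pow_mul (φ := PowerSeries.C (ε ^ 2)
      - PowerSeries.C (c₃ - τ) * PowerSeries.X ^ 5 + PowerSeries.C (ε * τ) * PowerSeries.X ^ 6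
      - PowerSeries.C c₄ * PowerSeries.X ^ 11) ?_ (by simpa using hε)⟩
    simp only [hD, hE, hF, hG, Subalgebra.coe_sub, Subalgebra.coe_mul, Subalgebra.coe_smul, coe_mon,
      coe_stdF, coe_stdG, PowerSeries.smul_eq_C_mul, map_mul, map_pow, map_sub, map_ofNat]
    ring
  · refine ⟨ε • (mon k 11 (by norm_num) * E) - mon k 5 (by norm_num) * D,
      sub_mem (smul_mem_ideal _ (Ideal.mul_mem_left _ _ hEI)) (Ideal.mul_mem_left _ _ hDI),
      order_of_eq_X_pow_mul (φ := PowerSeries.C (ε ^ 3)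
      + PowerSeries.C (c₃ - τ) * PowerSeries.X ^ 4
      + PowerSeries.C (ε * (c₃ - τ) - ε * τ) * PowerSeries.X ^ 5
      + PowerSeries.C c₄ * PowerSeries.X ^ 10 + PowerSeries.C (ε * c₄) * PowerSeries.X ^ 11)
      ?_ (by simpa using hε)⟩
    simp only [hD, hE, hF, hG, Subalgebra.coe_sub, Subalgebra.coe_mul, Subalgebra.coe_smul, coe_mon,
      coe_stdF, coe_stdG, PowerSeries.smul_eq_C_mul, map_mul, map_pow, map_sub, map_ofNat]
    ring

theorem exists_sq_eq_mul {ε : k} (hε : ε ≠ 0) (c₄ τ : k) :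
    ∃ K ∈ Ideal.span {stdF (3 * ε) (ε ^ 2) (2 * τ - 55 * ε ^ 7) c₄, stdG (2 * ε) τ},
      stdG (2 * ε) τ * stdG (2 * ε) τ = stdF (3 * ε) (ε ^ 2) (2 * τ - 55 * ε ^ 7) c₄ * K := by
  set c₃ := 2 * τ - 55 * ε ^ 7 with hc₃
  have hu := constantCoeff_unitF (3 * ε) (ε ^ 2) c₃ c₄
  set κ : k⟦X⟧ := unitG (2 * ε) τ * unitG (2 * ε) τ * (unitF (3 * ε) (ε ^ 2) c₃ c₄)⁻¹ with hκ
  have hκF : κ * unitF (3 * ε) (ε ^ 2) c₃ c₄ = unitG (2 * ε) τ * unitG (2 * ε) τ := by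
    rw [hκ, mul_assoc, PowerSeries.inv_mul_cancel _ (by rw [hu]; exact one_ne_zero), mul_one]
  obtain ⟨κ0, κ1, κ2, κ7⟩ := coeff_sq_div hκF
  replace κ7 := κ7 ε rfl rfl rfl
  have hK : PowerSeries.X ^ 32 * κ ∈ A511 k := by
    rw [mem_A511_iff]
    intro n hn
    rw [PowerSeries.coeff_X_pow_mul']
    split_ifs with h
    -- These are the only gaps of H above 32; c₂ and c₃ are chosen to kill κ there.
    · have : n = 34 ∨ n = 39 := by omega
      rcases this with rfl | rfl
      · rw [κ2]; ring
      · rw [κ7, hc₃]; ring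
    · rfl
  set K : A511 k := ⟨_, hK⟩ with hKdef
  set I := Ideal.span {stdF (3 * ε) (ε ^ 2) c₃ c₄, stdG (2 * ε) τ} with hI
  refine ⟨K, ?_, ?_⟩
  · set E := mon k 11 (by norm_num) * stdF (3 * ε) (ε ^ 2) c₃ c₄
      - mon k 5 (by norm_num) * stdG (2 * ε) τ with hE
    have hEI : E ∈ I := sub_mem (Ideal.mul_mem_left _ _ (Ideal.subset_span (by simp)))
        (Ideal.mul_mem_left _ _ (Ideal.subset_span (by simp)))
    have hE' : (E : k⟦X⟧) = PowerSeries.X ^ 32 * (PowerSeries.C ε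
        + PowerSeries.C (ε ^ 2) * PowerSeries.X ^ 1 + PowerSeries.C (c₃ - τ) * PowerSeries.X ^ 6
        + PowerSeries.C c₄ * PowerSeries.X ^ 12) := by
      simp only [hE, Subalgebra.coe_sub, Subalgebra.coe_mul, coe_mon, coe_stdF, coe_stdG,
        PowerSeries.smul_eq_C_mul, map_mul, map_pow, map_sub, map_ofNat]
      ring
    have hEI' := smul_mem_ideal ε⁻¹ hEI
    obtain ⟨r, h1, h2, h3⟩ := exists_reduced (exists_orders_span_std hε c₃ c₄ τ) 34 (by norm_num)
      (K - ε⁻¹ • E)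
    -- K and ε⁻¹E agree through degree 33, and every element of H from 34 on lies in 20 + ⟨5, 6⟩, so
    -- nothing survives reduction.
    have hr : r = 0 := by
      apply Subtype.ext
      ext n
      rw [ZeroMemClass.coe_zero, map_zero]
      rcases lt_or_ge n 34 with h4 | h4
      · rw [h2 n h4]
        rw [hKdef, Subalgebra.coe_sub, Subalgebra.coe_smul, hE', map_sub, PowerSeries.coeff_smul,
          PowerSeries.coeff_X_pow_mul', PowerSeries.coeff_X_pow_mul']
        split_ifs with h5
        · have h6 : n = 32 ∨ n = 33 := by omega
          rcases h6 with rfl | rfl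
          · rw [κ0]
            simp [hε]
          · rw [κ1]
            simp only [map_add, PowerSeries.coeff_C_mul, PowerSeries.coeff_X_pow,
              PowerSeries.coeff_C, smul_eq_mul]
            norm_num
            field_simp
            ring
        · simp
      · by_cases h5 : n = 34 ∨ n = 39
        · exact coeff_eq_zero_of_gap r (by omega)
        · exact h3 n h4 (by omega)
    rw [hr, sub_zero] at h1
    exact (Submodule.sub_mem_iff_left I hEI').mp h1
  · apply Subtype.ext
    have := PowerSeries.mul_inv_cancel (unitF (3 * ε) (ε ^ 2) c₃ c₄) (by rw [hu]; exact one_ne_zero)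
    rw [Subalgebra.coe_mul, Subalgebra.coe_mul, coe_stdF_eq_mul, coe_stdG_eq_mul, hKdef, ← mul_one
      (_ * _), ← this]
    ring

end Sufficiency

/-! ### Freeness of I/I² via the colon ideal (F) : G. -/

section Free

variable {k : Type*} [Field k]

theorem sq_eq_span_std {ε : k} (hε : ε ≠ 0) (c₄ τ : k) {F G : A511 k}
    (hF : F = stdF (3 * ε) (ε ^ 2) (2 * τ - 55 * ε ^ 7) c₄) (hG : G = stdG (2 * ε) τ) :
    Ideal.span {F, G} ^ 2 = Ideal.span {F} * Ideal.span {F, G} := by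
  obtain ⟨K, hK, hGG⟩ := exists_sq_eq_mul hε c₄ τ
  rw [← hF, ← hG] at hK hGG
  have hFI : F ∈ Ideal.span {F, G} := Ideal.subset_span (by simp)
  have hGI : G ∈ Ideal.span {F, G} := Ideal.subset_span (by simp)
  apply le_antisymm
  · rw [sq, Ideal.span_pair_mul_span_pair, Ideal.span_le]
    rintro z (rfl | rfl | rfl | rfl)
    · exact Ideal.mem_span_singleton_mul.mpr ⟨F, hFI, rfl⟩
    · exact Ideal.mem_span_singleton_mul.mpr ⟨G, hGI, rfl⟩
    · exact Ideal.mem_span_singleton_mul.mpr ⟨G, hGI, mul_comm _ _⟩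
    · exact Ideal.mem_span_singleton_mul.mpr ⟨K, hK, hGG.symm⟩
  · rw [sq]
    exact Ideal.mul_mono_left ((Ideal.span_singleton_le_iff_mem _).mpr hFI)

/-- The first coefficients of `G / F`, up to the factor `t ^ 6`. -/
theorem coeff_div {q : k⟦X⟧} {ε c₃ c₄ τ : k}
    (h : q * unitF (3 * ε) (ε ^ 2) c₃ c₄ = unitG (2 * ε) τ) :
    PowerSeries.coeff 0 q = 1 ∧ PowerSeries.coeff 1 q = - ε ∧
    PowerSeries.coeff 2 q = 2 * ε ^ 2 ∧ PowerSeries.coeff 3 q = - 5 * ε ^ 3 := by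
  have key := fun n => congrArg (PowerSeries.coeff n) h
  simp only [coeff_mul_unitF, coeff_unitG] at key
  have h0 := key 0
  have h1 := key 1
  have h2 := key 2
  have h3 := key 3
  norm_num [-PowerSeries.coeff_zero_eq_constantCoeff] at h0 h1 h2 h3
  rw [h0] at h1 h2
  have e1 : PowerSeries.coeff 1 q = - ε := by linear_combination h1
  rw [e1] at h2 h3
  have e2 : PowerSeries.coeff 2 q = 2 * ε ^ 2 := by linear_combination h2
  rw [e2] at h3
  exact ⟨h0, e1, e2, by linear_combination h3⟩

/-- A reduced element of `A` multiplied into `A` by `G / F` is zero. -/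
theorem eq_zero_of_mul_mem {ε : k} (hε : ε ≠ 0) {q : k⟦X⟧}
    (h0 : PowerSeries.coeff 0 q = 1) (h1 : PowerSeries.coeff 1 q = - ε)
    (h2 : PowerSeries.coeff 2 q = 2 * ε ^ 2) (h3 : PowerSeries.coeff 3 q = - 5 * ε ^ 3)
    {b : A511 k}
    (hb : ∀ n, 20 + 6 * ((n - 20) % 5) ≤ n → PowerSeries.coeff n (b : k⟦X⟧) = 0)
    (hmem : PowerSeries.X ^ 6 * q * (b : k⟦X⟧) ∈ A511 k) : b = 0 := by
  obtain ⟨β, hβ⟩ : ∃ β : ℕ → k, ∀ n, PowerSeries.coeff n (b : k⟦X⟧) = β n := ⟨_, fun _ => rfl⟩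
  -- The listed exponents are the elements of H outside 20 + ⟨5, 6⟩.
  have hT : ∀ n, ¬ (n = 0 ∨ n = 5 ∨ n = 10 ∨ n = 11 ∨ n = 15 ∨ n = 16 ∨ n = 21 ∨ n = 22 ∨ n = 27
      ∨ n = 33) → β n = 0 := by
    intro n hn
    rw [← hβ]
    by_cases h : 20 + 6 * ((n - 20) % 5) ≤ n
    · exact hb n h
    · exact coeff_eq_zero_of_gap b (by omega)
  have hbsum : (b : k⟦X⟧) = β 0 • PowerSeries.X ^ 0 + β 5 • PowerSeries.X ^ 5
      + β 10 • PowerSeries.X ^ 10 + β 11 • PowerSeries.X ^ 11 + β 15 • PowerSeries.X ^ 15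
      + β 16 • PowerSeries.X ^ 16 + β 21 • PowerSeries.X ^ 21 + β 22 • PowerSeries.X ^ 22
      + β 27 • PowerSeries.X ^ 27 + β 33 • PowerSeries.X ^ 33 := by
    ext n
    simp only [hβ, map_add, PowerSeries.coeff_smul, PowerSeries.coeff_X_pow, smul_eq_mul]
    by_cases h : n = 0 ∨ n = 5 ∨ n = 10 ∨ n = 11 ∨ n = 15 ∨ n = 16 ∨ n = 21 ∨ n = 22 ∨ n = 27
      ∨ n = 33
    · rcases h with rfl | rfl | rfl | rfl | rfl | rfl | rfl | rfl | rfl | rfl <;> norm_num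
    · rw [hT n h]
      push Not at h
      obtain ⟨g0, g1, g2, g3, g4, g5, g6, g7, g8, g9⟩ := h
      simp only [g0, g1, g2, g3, g4, g5, g6, g7, g8, g9, if_false, mul_zero, add_zero]
  have key : ∀ n, n < 11 * (n % 5) →
      PowerSeries.coeff n (PowerSeries.X ^ 6 * q * (b : k⟦X⟧)) = 0 := mem_A511_iff.mp hmem
  rw [hbsum] at key
  simp only [mul_add, mul_smul_comm, map_add, PowerSeries.coeff_smul,
    PowerSeries.coeff_mul_X_pow', PowerSeries.coeff_X_pow_mul', smul_eq_mul] at key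
  -- Ten gaps of H give ten equations, solved in blocks: degrees 6, 12, 34, 39 each isolate one
  -- unknown, and the pairs (17, 18), (23, 24), (28, 29) are 2 × 2 systems of determinants ε², -ε⁴,
  -- ε² up to sign.
  have e6 := key 6 (by norm_num)
  have e12 := key 12 (by norm_num)
  have e17 := key 17 (by norm_num)
  have e18 := key 18 (by norm_num)
  have e23 := key 23 (by norm_num)
  have e24 := key 24 (by norm_num)
  have e28 := key 28 (by norm_num)
  have e29 := key 29 (by norm_num)
  have e34 := key 34 (by norm_num)
  have e39 := key 39 (by norm_num)
  clear key hbsum hmem hb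
  norm_num [h0, -PowerSeries.coeff_zero_eq_constantCoeff] at e6
  norm_num [h0, h1, h2, h3, e6, hε, -PowerSeries.coeff_zero_eq_constantCoeff] at e12
  norm_num [h0, h1, h2, h3, e6, e12, -PowerSeries.coeff_zero_eq_constantCoeff] at e17 e18
  have b10 : β 10 = 0 := by
    have : ε ^ 2 * β 10 = 0 := by linear_combination e18 + ε * e17
    exact (mul_eq_zero.mp this).resolve_left (pow_ne_zero 2 hε)
  have b11 : β 11 = 0 := by
    rw [b10] at e17
    linear_combination e17
  norm_num [h0, h1, h2, h3, e6, e12, b10, b11,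
    -PowerSeries.coeff_zero_eq_constantCoeff] at e23 e24
  have b15 : β 15 = 0 := by
    have : ε ^ 3 * β 15 = 0 := by linear_combination -e24 - 2 * ε * e23
    exact (mul_eq_zero.mp this).resolve_left (pow_ne_zero 3 hε)
  have b16 : β 16 = 0 := by
    rw [b15] at e23
    have : ε * β 16 = 0 := by linear_combination -e23
    exact (mul_eq_zero.mp this).resolve_left hε
  norm_num [h0, h1, h2, h3, e6, e12, b10, b11, b15, b16,
    -PowerSeries.coeff_zero_eq_constantCoeff] at e28 e29
  have b21 : β 21 = 0 := by
    have : ε ^ 2 * β 21 = 0 := by linear_combination e29 + ε * e28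
    exact (mul_eq_zero.mp this).resolve_left (pow_ne_zero 2 hε)
  have b22 : β 22 = 0 := by
    rw [b21] at e28
    linear_combination e28
  norm_num [h0, h1, h2, h3, e6, e12, b10, b11, b15, b16, b21, b22, hε,
    -PowerSeries.coeff_zero_eq_constantCoeff] at e34
  norm_num [h0, h1, h2, h3, e6, e12, b10, b11, b15, b16, b21, b22, e34,
    -PowerSeries.coeff_zero_eq_constantCoeff] at e39
  apply Subtype.ext
  ext n
  rw [hβ, ZeroMemClass.coe_zero, map_zero]
  by_cases h : n = 0 ∨ n = 5 ∨ n = 10 ∨ n = 11 ∨ n = 15 ∨ n = 16 ∨ n = 21 ∨ n = 22 ∨ n = 27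
      ∨ n = 33
  · rcases h with rfl | rfl | rfl | rfl | rfl | rfl | rfl | rfl | rfl | rfl <;> assumption
  · exact hT n h

/-- `(F) : G` is contained in `I = (F, G)`. -/
theorem mem_of_mul_eq {ε : k} (hε : ε ≠ 0) (c₄ τ : k) {F G : A511 k}
    (hF : F = stdF (3 * ε) (ε ^ 2) (2 * τ - 55 * ε ^ 7) c₄) (hG : G = stdG (2 * ε) τ)
    {a b : A511 k} (h : b * G = F * a) : b ∈ Ideal.span {F, G} := by
  have hord := exists_orders_span_std hε (2 * τ - 55 * ε ^ 7) c₄ τ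
  rw [← hF, ← hG] at hord
  obtain ⟨b', h1, -, h3⟩ := exists_reduced hord 0 (by norm_num) b
  have hsq := sq_eq_span_std hε c₄ τ hF hG
  -- Replacing b by b' changes bG by an element of I² = FI, so divisibility by F persists.
  have h4 : (b - b') * G ∈ Ideal.span {F} * Ideal.span {F, G} := by
    rw [← hsq, sq]
    exact Ideal.mul_mem_mul h1 (Ideal.subset_span (by simp))
  obtain ⟨z, -, hz⟩ := Ideal.mem_span_singleton_mul.mp h4
  have h5 : b' * G = F * (a - z) := by linear_combination h + hz
  have hu := constantCoeff_unitF (3 * ε) (ε ^ 2) (2 * τ - 55 * ε ^ 7) c₄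
  have hinv := PowerSeries.inv_mul_cancel (unitF (3 * ε) (ε ^ 2) (2 * τ - 55 * ε ^ 7) c₄)
    (by rw [hu]; exact one_ne_zero)
  obtain ⟨q, hq⟩ : ∃ q : k⟦X⟧, q * unitF (3 * ε) (ε ^ 2) (2 * τ - 55 * ε ^ 7) c₄
      = unitG (2 * ε) τ :=
    ⟨unitG (2 * ε) τ * (unitF (3 * ε) (ε ^ 2) (2 * τ - 55 * ε ^ 7) c₄)⁻¹,
      by rw [mul_assoc, hinv, mul_one]⟩
  obtain ⟨q0, q1, q2, q3⟩ := coeff_div hq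
  have hF0 : (F : k⟦X⟧) ≠ 0 := fun h0 => by
    have := order_stdF (3 * ε) (ε ^ 2) (2 * τ - 55 * ε ^ 7) c₄
    rw [← hF, h0, PowerSeries.order_zero] at this
    exact absurd this (by decide)
  have h6 : PowerSeries.X ^ 6 * q * (b' : k⟦X⟧) = ((a - z : A511 k) : k⟦X⟧) := by
    apply mul_left_cancel₀ hF0
    have h7 := congrArg (fun z : A511 k => (z : k⟦X⟧)) h5
    simp only [Subalgebra.coe_mul] at h7
    rw [← h7, hF, hG, coe_stdF_eq_mul, coe_stdG_eq_mul, ← hq]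
    ring
  have h8 := eq_zero_of_mul_mem hε q0 q1 q2 q3 (fun n hn => h3 n (Nat.zero_le _) hn)
    (h6 ▸ (a - z).2)
  rwa [h8, sub_zero] at h1

/-- If `I = (F, G)`, `I ^ 2 = F I` and `(F) : G ≤ I`, then `I / I ^ 2` is free over `R / I`. -/
theorem free_cotangent_of_colon_le {R : Type*} [CommRing R] [IsDomain R] {F G : R} {I : Ideal R}
    (hI : I = Ideal.span {F, G}) (hF0 : F ≠ 0) (hsq : I ^ 2 = Ideal.span {F} * I)
    (hmem : ∀ a b : R, b * G = F * a → b ∈ I) : Module.Free (R ⧸ I) I.Cotangent := by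
  have hFI : F ∈ I := hI ▸ Ideal.subset_span (by simp)
  have hGI : G ∈ I := hI ▸ Ideal.subset_span (by simp)
  have hsmul : ∀ a b : R,
      (Ideal.Quotient.mk I a) • I.toCotangent ⟨F, hFI⟩ + (Ideal.Quotient.mk I b) •
        I.toCotangent ⟨G, hGI⟩
      = I.toCotangent ⟨a * F + b * G, add_mem (I.mul_mem_left _ hFI) (I.mul_mem_left _ hGI)⟩ := by
    intro a b
    exact ((I.toCotangent.map_add (a • ⟨F, hFI⟩) (b • ⟨G, hGI⟩)).trans
      (by rw [map_smul, map_smul])).symm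
  have hli : LinearIndependent (R ⧸ I) ![I.toCotangent ⟨F, hFI⟩, I.toCotangent ⟨G, hGI⟩] := by
    rw [LinearIndependent.pair_iff]
    intro s t hst
    obtain ⟨a, rfl⟩ := Ideal.Quotient.mk_surjective s
    obtain ⟨b, rfl⟩ := Ideal.Quotient.mk_surjective t
    rw [hsmul, Ideal.toCotangent_eq_zero, hsq] at hst
    obtain ⟨z, hz, hFz⟩ := Ideal.mem_span_singleton_mul.mp hst
    have hb : b ∈ I := hmem (z - a) b (by linear_combination -hFz)
    -- From b ∈ I it follows that bG = Fy with y ∈ I; cancelling F then puts a in I as well.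
    have hbG : b * G ∈ Ideal.span {F} * I := by
      rw [← hsq, sq]
      exact Ideal.mul_mem_mul hb hGI
    obtain ⟨y, hy, hFy⟩ := Ideal.mem_span_singleton_mul.mp hbG
    have ha : a = z - y := by
      apply mul_left_cancel₀ hF0
      linear_combination -hFz + hFy
    exact ⟨Ideal.Quotient.eq_zero_iff_mem.mpr (ha ▸ sub_mem hz hy),
      Ideal.Quotient.eq_zero_iff_mem.mpr hb⟩
  refine Module.Free.of_basis (Module.Basis.mk hli ?_)
  rintro x -
  obtain ⟨⟨z, hz⟩, rfl⟩ := I.toCotangent_surjective x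
  obtain ⟨a, b, hab⟩ := Ideal.mem_span_pair.mp (hI ▸ hz)
  have : I.toCotangent ⟨z, hz⟩ = (Ideal.Quotient.mk I a) • I.toCotangent ⟨F, hFI⟩ +
      (Ideal.Quotient.mk I b) • I.toCotangent ⟨G, hGI⟩ := by
    rw [hsmul]
    congr 2
    exact hab.symm
  rw [this]
  exact add_mem (Submodule.smul_mem _ _ (Submodule.subset_span ⟨0, rfl⟩))
    (Submodule.smul_mem _ _ (Submodule.subset_span ⟨1, rfl⟩))

theorem free_cotangent {ε : k} (hε : ε ≠ 0) (c₄ τ : k) {F G : A511 k}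
    (hF : F = stdF (3 * ε) (ε ^ 2) (2 * τ - 55 * ε ^ 7) c₄) (hG : G = stdG (2 * ε) τ) :
    Module.Free (A511 k ⧸ Ideal.span {F, G}) (Ideal.span {F, G}).Cotangent := by
  refine free_cotangent_of_colon_le rfl (fun h0 => ?_) (sq_eq_span_std hε c₄ τ hF hG)
    fun a b => mem_of_mul_eq hε c₄ τ hF hG
  have := order_stdF (3 * ε) (ε ^ 2) (2 * τ - 55 * ε ^ 7) c₄
  rw [← hF, h0, ZeroMemClass.coe_zero, PowerSeries.order_zero] at this
  exact absurd this (by decide)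

end Free

/-! ### Radicals and Krull dimension. -/

section Dimension

variable {k : Type*} [Field k]

/-- If p has order n, then r^(n + 40)/p has order at least 40 for r in the maximal ideal, so it lies
in A. -/
theorem maximalIdeal_le_radical_span {p : A511 k} (hp : p ≠ 0) :
    IsLocalRing.maximalIdeal (A511 k) ≤ (Ideal.span {p}).radical := by
  intro r hr
  rw [mem_maximalIdeal_iff] at hr
  have hr' : (PowerSeries.X : k⟦X⟧) ∣ r := by
    rw [PowerSeries.X_dvd_iff]
    simpa using hr
  obtain ⟨s, hs⟩ := hr'
  have hp0 : (p : k⟦X⟧) ≠ 0 := fun h => hp (Subtype.ext h)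
  obtain ⟨n, hn⟩ := ENat.ne_top_iff_exists.mp (PowerSeries.order_eq_top.not.mpr hp0)
  obtain ⟨h1, h2⟩ := PowerSeries.order_eq_nat.mp hn.symm
  obtain ⟨φ, hφ⟩ := PowerSeries.X_pow_dvd_iff.mpr h2
  have hφ0 : PowerSeries.constantCoeff φ ≠ 0 := by
    rw [hφ, PowerSeries.coeff_X_pow_mul'] at h1
    simpa using h1
  refine ⟨n + 40, Ideal.mem_span_singleton.mpr ⟨⟨PowerSeries.X ^ 40 * (φ⁻¹ * s ^ (n + 40)),
    mem_A511_of_coeff_lt (PowerSeries.X_pow_dvd_iff.mp (dvd_mul_right _ _))⟩, Subtype.ext ?_⟩⟩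
  rw [Subalgebra.coe_mul, Subalgebra.coe_pow, hs, hφ]
  have := PowerSeries.mul_inv_cancel φ hφ0
  calc (PowerSeries.X * s) ^ (n + 40)
      = PowerSeries.X ^ n * PowerSeries.X ^ 40 * s ^ (n + 40) * 1 := by ring
    _ = _ := by rw [← this]; ring

theorem radical_eq_maximalIdeal {I : Ideal (A511 k)} {p : A511 k} (hp : p ≠ 0) (hpI : p ∈ I)
    (hI : I ≤ IsLocalRing.maximalIdeal (A511 k)) :
    I.radical = IsLocalRing.maximalIdeal (A511 k) := by
  apply le_antisymm
  · rw [← (IsLocalRing.maximalIdeal.isMaximal (A511 k)).isPrime.radical]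
    exact Ideal.radical_mono hI
  · exact (maximalIdeal_le_radical_span hp).trans
      (Ideal.radical_mono ((Ideal.span_singleton_le_iff_mem _).mpr hpI))

theorem ringKrullDim_A511 : ringKrullDim (A511 k) = 1 := by
  rw [ringKrullDim_eq_one_iff_of_isLocalRing_isDomain]
  refine ⟨fun h => ?_, fun x hx => maximalIdeal_le_radical_span hx⟩
  rw [IsLocalRing.isField_iff_maximalIdeal_eq] at h
  have h1 : mon k 5 (by norm_num) ∈ IsLocalRing.maximalIdeal (A511 k) := by
    rw [mem_maximalIdeal_iff, coe_mon, PowerSeries.coeff_X_pow]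
    norm_num
  rw [h, Ideal.mem_bot] at h1
  exact pow_ne_zero 5 PowerSeries.X_ne_zero (congrArg (fun z : A511 k => (z : k⟦X⟧)) h1)

end Dimension

/-! ### Assembly of the Ulrich property and the classification. -/

section Main

variable {k : Type*} [Field k]

theorem six_notMem_valueSet : 6 ∉ valueSet (A511 k) := by
  rintro ⟨f, hf, hfo⟩
  exact (PowerSeries.order_eq_nat.mp hfo).1 (mem_A511_iff.mp hf 6 (by norm_num))

theorem isUlrich_and_hasInvariants {ε : k} (hε : ε ≠ 0) (δ τ : k) :
    IsUlrich (Ideal.span {genF δ ε τ, genG ε τ}) ∧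
      HasInvariants (Ideal.span {genF δ ε τ, genG ε τ}) 20 26 := by
  have hsq := sq_eq_span_std hε δ τ (genF_eq δ ε τ) (genG_eq ε τ)
  have hfree := free_cotangent hε δ τ (genF_eq δ ε τ) (genG_eq ε τ)
  have hFo : (genF δ ε τ : k⟦X⟧).order = 20 := order_stdF ..
  have hGo : (genG ε τ : k⟦X⟧).order = 26 := order_stdG ..
  set F := genF δ ε τ
  set G := genG ε τ
  obtain ⟨hF1, hF2⟩ := (PowerSeries.order_eq_nat (n := 20)).mp hFo
  obtain ⟨hG1, hG2⟩ := (PowerSeries.order_eq_nat (n := 26)).mp hGo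
  have hF0 : F ≠ 0 := fun h => hF1 (by rw [h]; simp)
  have hFI : F ∈ Ideal.span {F, G} := Ideal.subset_span (by simp)
  have hGI : G ∈ Ideal.span {F, G} := Ideal.subset_span (by simp)
  have hFm : F ∈ IsLocalRing.maximalIdeal (A511 k) :=
    (mem_maximalIdeal_iff F).mpr (hF2 0 (by norm_num))
  have hGm : G ∈ IsLocalRing.maximalIdeal (A511 k) :=
    (mem_maximalIdeal_iff G).mpr (hG2 0 (by norm_num))
  refine ⟨⟨radical_eq_maximalIdeal hF0 hFI ?_, ⟨Ideal.span {F}, ⟨1, fun _ => F, ?_, ?_, ?_⟩,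
    (Ideal.span_singleton_le_iff_mem _).mpr hFI, fun h => ?_, hsq⟩, hfree⟩,
    F, G, rfl, hsq, hFo, hGo, by norm_num, six_notMem_valueSet⟩
  · rw [Ideal.span_le]
    rintro z (rfl | rfl)
    · exact hFm
    · exact hGm
  · exact_mod_cast ringKrullDim_A511
  · rw [Set.range_const]
  · exact radical_eq_maximalIdeal hF0 (Ideal.mem_span_singleton_self F)
      ((Ideal.span_singleton_le_iff_mem _).mpr hFm)
  · rw [h, Ideal.mem_span_singleton] at hGI
    obtain ⟨c, hc⟩ := hGI
    -- G = cF would require c to have order 6, a gap of H.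
    have h1 : c * F + 0 * G = G := by rw [hc]; ring
    have h2 := ((coeff_comb_low hFo hGo h1).2 hG2).2
    exact hG1 (by simpa using h2)

end Main

end UlrichIdeals

theorem mainTheorem1 (k : Type*) [Field k] :
    {I : Ideal (UlrichIdeals.A511 k) |
        UlrichIdeals.IsUlrich I ∧ UlrichIdeals.HasInvariants I 20 26} =
      {I : Ideal (UlrichIdeals.A511 k) | ∃ δ ε τ : k, ε ≠ 0 ∧
        I = Ideal.span {UlrichIdeals.genF δ ε τ, UlrichIdeals.genG ε τ}} ∧
    ∀ δ ε τ δ' ε' τ' : k, ε ≠ 0 → ε' ≠ 0 →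
      Ideal.span {UlrichIdeals.genF δ ε τ, UlrichIdeals.genG ε τ} =
        Ideal.span {UlrichIdeals.genF δ' ε' τ', UlrichIdeals.genG ε' τ'} →
      δ = δ' ∧ ε = ε' ∧ τ = τ' := by
  refine ⟨Set.ext fun I => ⟨fun h => UlrichIdeals.exists_eq_span_gen h.2, ?_⟩,
    fun _ _ _ _ _ _ hε _ h => UlrichIdeals.span_gen_injective hε h⟩
  rintro ⟨δ, ε, τ, hε, rfl⟩
  exact UlrichIdeals.isUlrich_and_hasInvariants hε δ τ
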